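/- **Setting.** Let $F:\mathbb{R}^d\to\mathbb{R}$ be differentiable and bounded below, with $\|\nabla F(x)\|\le G$ for all $x$ (Euclidean norm), and well-behaved, meaning $F(y)-F(x)=\int_0^1\langle\nabla F(x+t(y-x)),\,y-x\rangle\,dt$ for all $x,y$. Fix $x_0\in\mathbb{R}^d$ and put $\Delta=F(x_0)-\inf F$. Let $\mathrm{StoGrad}:\mathbb{R}^d\times\mathcal{Z}\to\mathbb{R}^d$ be a measurable stochastic gradient oracle: for a probability distribution $\nu$ on $\mathcal{Z}$, some $\sigma\ge 0$ and every $x$, the vector $g=\mathrm{StoGrad}(x,r)$, $r\sim\nu$, satisfies $\mathbb{E}[g]=\nabla F(x)$ and $\mathbb{E}\|g-\nabla F(x)\|^2\le\sigma^2$. For $\lambda>0$ let $$\|\nabla F(x)\|^{[\lambda]}=\inf_{p\,:\,\mathbb{E}_{y\sim p}[y]=x}\Big\{\big\|\mathbb{E}_{y\sim p}[\nabla F(y)]\big\|+\lambda\,\mathbb{E}_{y\sim p}\|y-x\|^2\Big\},$$ the infimum being over probability measures $p$ on $\mathbb{R}^d$ for which these expectations exist; $x$ is called a $(\lambda,\varepsilon')$-stationary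 point of $F$ if $\|\nabla F(x)\|^{[\lambda]}\le\varepsilon'$. **Algorithm** (discounted-to-nonconvex conversion with $\beta$-FTRL). Let $\alpha_1,\alpha_2,\dots\sim\mathrm{Exp}(1)$ and $r_1,r_2,\dots\sim\nu$ all be mutually independent. For $t=1,\dots,T$ put $$z_t=-\mathrm{clip}_D\!\left(D\,\frac{\sum_{s=1}^{t-1}\beta^{-s}g_s}{\sqrt{\sum_{s=1}^{t-1}\beta^{-2s}\|g_s\|^2}}\right),\qquad x_t=x_{t-1}+\alpha_t z_t,\qquad g_t=\mathrm{StoGrad}(x_t,r_t),$$ $$\bar x_t=\frac{\beta-\beta^t}{1-\beta^t}\,\bar x_{t-1}+\frac{1-\beta}{1-\beta^t}\,x_t,$$ where $\mathrm{clip}_D(x)=x\min(D/\|x\|,1)$, and $z_t=0$ if the denominator vanishes. **Theorem.** Let $\lambda>0$, $C>0$ and $0<\varepsilon<10C$ (so that $\beta\in(0,1)$ below), and take $$\beta=1-\Big(\frac{\varepsilon}{10C}\Big)^2,\qquad D=\frac{(1-\beta)\,\varepsilon^{1/2}}{4\lambda^{1/2}},\qquad T=\left\lceil\frac{1}{1-\beta}\max\Big\{\frac{4\Delta\lambda^{1/2}}{\varepsilon^{3/2}},\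 \frac{12C}{\varepsilon}\Big\}\right\rceil .$$ Then $T\ge 1$, the random variables $\|\nabla F(\bar x_t)\|^{[\lambda]}$, $1\le t\le T$, are integrable, and $$\frac1T\sum_{t=1}^T\mathbb{E}\,\|\nabla F(\bar x_t)\|^{[\lambda]}\;\le\;\Big(\frac{17}{16}+\frac{G+\sigma}{C}\Big)\varepsilon .$$ If moreover $C\le G+\sigma$, then $$\frac1T\sum_{t=1}^T\mathbb{E}\,\|\nabla F(\bar x_t)\|^{[\lambda]}\;\le\;\Big(1+\frac{G+\sigma}{C}\Big)\varepsilon .$$ In other words, a uniformly random model-EMA iterate $\bar x_t$ is, in expectation, a $(\lambda,(\tfrac{17}{16}+\tfrac{G+\sigma}{C})\varepsilon)$-stationary point, and a $(\lambda,(1+\tfrac{G+\sigma}{C})\varepsilon)$-stationary point when $C\le G+\sigma$. -/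

import Mathlib

open MeasureTheory ProbabilityTheory
open scoped BigOperators

noncomputable section

/-- The regularized gradient norm of `F` at `x`: the infimum, over all probability measures `p`
on the space with mean `x`, of `‖𝔼 ∇F(y)‖ + lam * 𝔼 ‖y - x‖ ^ 2`, `y ∼ p`. The integrability
clauses say that the three expectations exist. The set is bounded below by `0` and, thanks to the
Dirac mass at `x`, nonempty. -/
def regGradNorm {E : Type*} [NormedAddCommGroup E] [InnerProductSpace ℝ E] [CompleteSpace E]
    [MeasurableSpace E] (lam : ℝ) (F : E → ℝ) (x : E) : ℝ :=
  sInf {c : ℝ | ∃ p : Measure E, IsProbabilityMeasure p ∧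
    Integrable (fun y => y) p ∧ ∫ y, y ∂p = x ∧
    Integrable (fun y => gradient F y) p ∧
    Integrable (fun y => ‖y - x‖ ^ 2) p ∧
    c = ‖∫ y, gradient F y ∂p‖ + lam * ∫ y, ‖y - x‖ ^ 2 ∂p}

/-- Well-behavedness: increments of `F` are line integrals of its gradient. -/
def WellBehaved {E : Type*} [NormedAddCommGroup E] [InnerProductSpace ℝ E] [CompleteSpace E]
    (F : E → ℝ) : Prop :=
  ∀ x y : E, F y - F x = ∫ t in (0 : ℝ)..1, inner ℝ (gradient F (x + t • (y - x))) (y - x)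

/-- `stoGrad` is an unbiased stochastic gradient oracle for `F`, with randomness distributed
according to `ν` and with variance at most `sigma ^ 2` at every point. -/
structure IsStoGradOracle {E Z : Type*} [NormedAddCommGroup E] [InnerProductSpace ℝ E]
    [CompleteSpace E] [MeasurableSpace E] [MeasurableSpace Z]
    (F : E → ℝ) (stoGrad : E → Z → E) (ν : Measure Z) (sigma : ℝ) : Prop where
  measurable : Measurable (Function.uncurry stoGrad)
  integrable : ∀ x, Integrable (stoGrad x) ν
  unbiased : ∀ x, ∫ r, stoGrad x r ∂ν = gradient F x
  integrable_sq : ∀ x, Integrable (fun r => ‖stoGrad x r - gradient F x‖ ^ 2) ν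
  variance_le : ∀ x, ∫ r, ‖stoGrad x r - gradient F x‖ ^ 2 ∂ν ≤ sigma ^ 2

/-- The initial optimality gap `F x₀ - inf F`. -/
def initialGap {E : Type*} (F : E → ℝ) (x₀ : E) : ℝ := F x₀ - ⨅ x, F x

/-- An online linear learner: given the list of the loss vectors `v₁, …, v_{t-1}` received so far
(the most recent one first), it returns its decision `z_t`. -/
abbrev OnlineLearner (E : Type*) := List E → E

/-- The clipping operator `x ↦ x * min (D / ‖x‖) 1` (which fixes `0`). -/
def clip {E : Type*} [NormedAddCommGroup E] [NormedSpace ℝ E] (D : ℝ) (x : E) : E :=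
  min (D / ‖x‖) 1 • x

/-- Scale-free FTRL on the ball of radius `D`:
`z_t = - clip_D (D * (∑ v_s) / √(∑ ‖v_s‖ ^ 2))`. If all `v_s` vanish then `z_t = 0`. Run on the
loss vectors `v_s = β ^ (-s) • g_s` that the conversion below sends, it is `β`-FTRL. -/
def scaleFreeFTRL {E : Type*} [NormedAddCommGroup E] [NormedSpace ℝ E] (D : ℝ) :
    OnlineLearner E :=
  fun vs => - clip D ((D / Real.sqrt (vs.map (fun v => ‖v‖ ^ 2)).sum) • vs.sum)

/-- The state of the discounted-to-nonconvex conversion after a round: the iterate `x_t`, the model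
EMA `x̄_t`, and the loss vectors sent to the learner so far, most recent first. -/
structure ConversionState (E : Type*) where
  x : E
  xbar : E
  losses : List E

/-- Round `t` of the discounted-to-nonconvex conversion, with step-size randomness `a` and
oracle randomness `r`: receive `z_t` from the learner, set `x_t = x_{t-1} + a • z_t`, query
`g_t = stoGrad x_t r`, send the loss vector `β ^ (-t) • g_t`, and update the moving average. -/
def conversionStep {E Z : Type*} [NormedAddCommGroup E] [NormedSpace ℝ E]
    (stoGrad : E → Z → E) (A : OnlineLearner E) (β : ℝ) (t : ℕ) (a : ℝ) (r : Z)
    (S : ConversionState E) : ConversionState E :=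
  let z := A S.losses
  let x := S.x + a • z
  let g := stoGrad x r
  { x := x
    xbar := ((β - β ^ t) / (1 - β ^ t)) • S.xbar + ((1 - β) / (1 - β ^ t)) • x
    losses := ((β ^ t)⁻¹ • g) :: S.losses }

/-- The discounted-to-nonconvex conversion started at `x₀`, run along the realizations
`a 1, a 2, …` and `r 1, r 2, …` of the randomness; the state after round `t`. The value of `x̄₀` is
immaterial, since its coefficient in round `1` is `0`. -/
def conversion {E Z : Type*} [NormedAddCommGroup E] [NormedSpace ℝ E]
    (stoGrad : E → Z → E) (A : OnlineLearner E) (β : ℝ) (x₀ : E) (a : ℕ → ℝ) (r : ℕ → Z) :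
    ℕ → ConversionState E
  | 0 => { x := x₀, xbar := x₀, losses := [] }
  | t + 1 => conversionStep stoGrad A β (t + 1) (a (t + 1)) (r (t + 1))
      (conversion stoGrad A β x₀ a r t)

end

/-! An exponential step length makes the linear model of `F` exact in expectation. If `a` is
`Exp(1)`-distributed, integration by parts against the density `exp (-a)` gives `𝔼[F(x + a z) - F x]
= 𝔼⟨∇F(x + a z), z⟩`, without any smoothness of the gradient. The noise of `g_t` is uncorrelated
with `z_t`, so the sum over `t ≤ T` of `𝔼⟨g_t, z_t⟩` telescopes to `𝔼 F(x_T) - F(x₀) ≥ -Δ`.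

An upper bound comes from online learning. A plain sum is `1 - β` times the sum of its discounted
partial sums plus a boundary term (`sum_eq_discountedSum`). Each discounted sum of losses is
compared with the vector of length `D` opposite to the discounted sum of the true gradients
(`discounted_loss_le`). The price is the FTRL regret, `5/2 * D` times a discounted root sum of
squares, plus `D` times the norm of the discounted noise; after taking expectations both are `D`
times a quantity of order `(G + σ) / √(1 - β)`. Together the two bounds make the discounted averages
of the gradients short on average over `t` (`sum_integral_norm_discountedMean_le`).

The EMA `x̄_t` is the discounted average of `x_1, …, x_t`, so the discounted weights form an
admissible measure in the definition of `regGradNorm` (`regGradNorm_discountedMean_le`). Its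
gradient term is the quantity above. Its variance is at most `D² / (1 - β)²` in expectation, because
the iterates move by at most `D` per round in expectation and the weights remember about `1 / (1 -
β)` rounds (`integral_discountedVariance`). `parameter_bound` then balances the terms. -/

set_option linter.unusedSectionVars false

/-! ### Regret of scale-free FTRL on a ball. -/

section Regret

variable {E : Type*} [NormedAddCommGroup E]

/-- The sum of the squared norms of the vectors in a list. -/
noncomputable def sumSq (vs : List E) : ℝ := (vs.map (fun v => ‖v‖ ^ 2)).sum

theorem sumSq_cons (v : E) (vs : List E) : sumSq (v :: vs) = ‖v‖ ^ 2 + sumSq vs := by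
  simp [sumSq]

theorem sumSq_nonneg (vs : List E) : 0 ≤ sumSq vs := by
  refine List.sum_nonneg fun x hx => ?_
  obtain ⟨v, -, rfl⟩ := List.mem_map.1 hx
  positivity

theorem sum_eq_zero_of_sumSq_eq_zero (vs : List E) (h : sumSq vs = 0) : vs.sum = 0 := by
  induction vs with
  | nil => simp
  | cons v vs ih =>
    rw [sumSq_cons] at h
    have h1 := sumSq_nonneg vs
    have h2 : ‖v‖ ^ 2 = 0 := by nlinarith [sq_nonneg ‖v‖]
    have h3 : v = 0 := by simpa using h2
    rw [List.sum_cons, ih (by linarith), h3, add_zero]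

variable [InnerProductSpace ℝ E]

/-- The total linear loss of the learner `A` on the loss vectors `vs` (most recent first). -/
noncomputable def learnerLoss (A : OnlineLearner E) : List E → ℝ
  | [] => 0
  | v :: vs => inner ℝ v (A vs) + learnerLoss A vs

theorem norm_clip_le {D : ℝ} (hD : 0 ≤ D) (x : E) : ‖clip D x‖ ≤ D := by
  unfold clip
  rw [norm_smul, Real.norm_of_nonneg (le_min (by positivity) zero_le_one)]
  rcases eq_or_ne x 0 with rfl | hx
  · simpa using hD
  · calc min (D / ‖x‖) 1 * ‖x‖ ≤ D / ‖x‖ * ‖x‖ := by gcongr; exact min_le_left _ _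
      _ = D := div_mul_cancel₀ _ (norm_ne_zero_iff.2 hx)

theorem norm_scaleFreeFTRL_le {D : ℝ} (hD : 0 ≤ D) (vs : List E) : ‖scaleFreeFTRL D vs‖ ≤ D := by
  unfold scaleFreeFTRL
  rw [norm_neg]
  exact norm_clip_le hD _

/-- The regularized cumulative loss that scale-free FTRL minimizes over the ball. -/
noncomputable def ftrlObjective (D : ℝ) (vs : List E) (w : E) : ℝ :=
  inner ℝ vs.sum w + Real.sqrt (sumSq vs) / (2 * D) * ‖w‖ ^ 2

/-- First-order optimality of the FTRL decision on the ball. If the clip is inactive, the decision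
is the unconstrained minimizer and the gradient of the objective vanishes. If it is active, the
decision is `-D S / ‖S‖` with `S = vs.sum`, the gradient is a nonnegative multiple of `S`, and
Cauchy–Schwarz finishes. -/
theorem inner_ftrl_optimality {D : ℝ} (hD : 0 < D) (vs : List E) {w : E} (hw : ‖w‖ ≤ D) :
    0 ≤ inner ℝ (vs.sum + (Real.sqrt (sumSq vs) / D) • scaleFreeFTRL D vs)
      (w - scaleFreeFTRL D vs) := by
  rcases (sumSq_nonneg vs).eq_or_lt with h0 | h0
  · simp [sum_eq_zero_of_sumSq_eq_zero vs h0.symm, ← h0]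
  have ha : 0 < Real.sqrt (sumSq vs) := Real.sqrt_pos.2 h0
  set a := Real.sqrt (sumSq vs) with ha_def
  have hz : scaleFreeFTRL D vs = -(min (D / ‖(D / a) • vs.sum‖) 1 • ((D / a) • vs.sum)) := rfl
  rcases eq_or_ne vs.sum 0 with hS | hS
  · rw [hz, hS]; simp
  have hSn : 0 < ‖vs.sum‖ := norm_pos_iff.2 hS
  have hn : D / ‖(D / a) • vs.sum‖ = a / ‖vs.sum‖ := by
    rw [norm_smul, Real.norm_of_nonneg (by positivity)]
    field_simp
  rw [hn] at hz
  rcases le_total 1 (a / ‖vs.sum‖) with h1 | h1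
  · rw [min_eq_right h1, one_smul] at hz
    have : vs.sum + (a / D) • scaleFreeFTRL D vs = 0 := by
      rw [hz, smul_neg, smul_smul, show a / D * (D / a) = 1 by field_simp, one_smul, add_neg_cancel]
    simp [this]
  · rw [min_eq_left h1, smul_smul, show a / ‖vs.sum‖ * (D / a) = D / ‖vs.sum‖ by field_simp] at hz
    rw [hz, smul_neg, smul_smul, ← sub_eq_add_neg, sub_neg_eq_add]
    have h2 : vs.sum - (a / D * (D / ‖vs.sum‖)) • vs.sum = (1 - a / ‖vs.sum‖) • vs.sum := by
      rw [sub_smul, one_smul, show a / D * (D / ‖vs.sum‖) = a / ‖vs.sum‖ by field_simp]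
    rw [h2, inner_smul_left, inner_add_right, inner_smul_right, real_inner_self_eq_norm_sq]
    refine mul_nonneg (by simpa using h1) ?_
    have h3 : D / ‖vs.sum‖ * ‖vs.sum‖ ^ 2 = D * ‖vs.sum‖ := by field_simp
    rw [h3]
    have h4 := abs_le.1 ((abs_real_inner_le_norm vs.sum w).trans
      (mul_le_mul_of_nonneg_left hw hSn.le))
    nlinarith [h4.1]

/-- The objective is a quadratic, so its second-order expansion at the minimizer is exact and the
first-order term is nonnegative by `inner_ftrl_optimality`. The surplus quadratic term is what pays
for the movement of the decisions. -/
theorem ftrlObjective_ge {D : ℝ} (hD : 0 < D) (vs : List E) {w : E} (hw : ‖w‖ ≤ D) :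
    ftrlObjective D vs (scaleFreeFTRL D vs)
      + Real.sqrt (sumSq vs) / (2 * D) * ‖w - scaleFreeFTRL D vs‖ ^ 2 ≤ ftrlObjective D vs w := by
  have h := inner_ftrl_optimality hD vs hw
  set z := scaleFreeFTRL D vs
  set a := Real.sqrt (sumSq vs)
  have h1 : ‖w‖ ^ 2 = ‖z‖ ^ 2 + 2 * inner ℝ z (w - z) + ‖w - z‖ ^ 2 := by
    rw [← norm_add_sq_real, add_sub_cancel]
  rw [inner_add_left, inner_smul_left, inner_sub_right] at h
  simp only [conj_trivial] at h
  unfold ftrlObjective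
  have h2 : a / (2 * D) = a / D / 2 := by field_simp
  change inner ℝ vs.sum z + a / (2 * D) * ‖z‖ ^ 2 + a / (2 * D) * ‖w - z‖ ^ 2
    ≤ inner ℝ vs.sum w + a / (2 * D) * ‖w‖ ^ 2
  rw [h1, h2]
  linarith

/-- The cost of one round in a form that telescopes: `a` and `√(v² + a²)` are the root sums of
squares before and after a loss of norm `v`. Adding `a` to half of the left side gives the inner
product of `(a, v)` with `(1 - m²/4, m/2)`, whose squared norm `1 - (m²/4)(1 - m²/4)` is at most `1`
since `m ≤ 2`. -/
theorem linear_sub_quadratic_le {a v m : ℝ} (hm : 0 ≤ m) (hm2 : m ≤ 2) :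
    v * m - a * m ^ 2 / 2 ≤ 2 * (Real.sqrt (v ^ 2 + a ^ 2) - a) := by
  have h : a + (v * m - a * m ^ 2 / 2) / 2 ≤ Real.sqrt (v ^ 2 + a ^ 2) := by
    apply Real.le_sqrt_of_sq_le
    have h4 : 0 ≤ 1 - m ^ 2 / 4 := by nlinarith
    have h5 : 0 ≤ a ^ 2 * (1 - m ^ 2 / 4) * (m ^ 2 / 4) := by positivity
    nlinarith [sq_nonneg (v * (1 - m ^ 2 / 4) - a * (1 - m ^ 2 / 4) * m / 2),
      mul_nonneg h4 (sq_nonneg (v - a * m / 2))]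
  linarith

/-- Induction in the manner of "be the leader": passing from the minimizer `z` to the next one `w`
costs `‖v‖ ‖w - z‖` minus the quadratic surplus, hence at most `2 * D` times the increment of the
root sum of squares. -/
theorem learnerLoss_le_ftrlObjective {D : ℝ} (hD : 0 < D) (vs : List E) :
    learnerLoss (scaleFreeFTRL D) vs
      ≤ ftrlObjective D vs (scaleFreeFTRL D vs) + 2 * D * Real.sqrt (sumSq vs) := by
  induction vs with
  | nil => simp [learnerLoss, ftrlObjective, sumSq]
  | cons v vs ih =>
    set z := scaleFreeFTRL D vs
    have hw := norm_scaleFreeFTRL_le hD.le (v :: vs)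
    have hz : ‖z‖ ≤ D := norm_scaleFreeFTRL_le hD.le vs
    set w := scaleFreeFTRL D (v :: vs)
    have h1 : learnerLoss (scaleFreeFTRL D) (v :: vs)
      = inner ℝ v z + learnerLoss (scaleFreeFTRL D) vs := rfl
    have h2 := ftrlObjective_ge hD vs hw
    change _ + _ * ‖w - z‖ ^ 2 ≤ _ at h2
    set a := Real.sqrt (sumSq vs)
    set b := Real.sqrt (sumSq (v :: vs)) with hb
    have ha0 : 0 ≤ a := Real.sqrt_nonneg _
    have ha2 : a ^ 2 = sumSq vs := Real.sq_sqrt (sumSq_nonneg vs)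
    rw [sumSq_cons, ← ha2] at hb
    have hab : a ≤ b := by
      rw [hb]; apply Real.le_sqrt_of_sq_le; nlinarith [sq_nonneg ‖v‖]
    have h3 : ftrlObjective D (v :: vs) w = ftrlObjective D vs w + inner ℝ v w
        + (b - a) / (2 * D) * ‖w‖ ^ 2 := by
      unfold ftrlObjective
      rw [List.sum_cons, inner_add_left]
      change _ + b / (2 * D) * _ = _ + a / (2 * D) * _ + _ + _
      ring
    have h4 : 0 ≤ (b - a) / (2 * D) * ‖w‖ ^ 2 :=
      mul_nonneg (div_nonneg (by linarith) (by linarith)) (sq_nonneg _)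
    have h5 : inner ℝ v z - inner ℝ v w ≤ ‖v‖ * ‖w - z‖ := by
      rw [← inner_sub_right, norm_sub_rev]; exact real_inner_le_norm _ _
    have hn : ‖w - z‖ ≤ 2 * D := (norm_sub_le _ _).trans (by linarith)
    -- Distances are measured in units of `D`; two points of the ball are then at most `2` apart.
    have h6 := linear_sub_quadratic_le (a := a) (v := ‖v‖) (m := ‖w - z‖ / D) (by positivity)
      ((div_le_iff₀ hD).2 hn)
    rw [← hb] at h6
    have h7 : ‖v‖ * ‖w - z‖ - a / (2 * D) * ‖w - z‖ ^ 2
        = D * (‖v‖ * (‖w - z‖ / D) - a * (‖w - z‖ / D) ^ 2 / 2) := by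
      field_simp
    have h8 := mul_le_mul_of_nonneg_left h6 hD.le
    rw [← h7] at h8
    rw [h1, h3]
    linarith

/-- The regret of scale-free FTRL on the ball of radius `D`. -/
theorem learnerLoss_scaleFreeFTRL_le {D : ℝ} (hD : 0 < D) (vs : List E) {u : E} (hu : ‖u‖ ≤ D) :
    learnerLoss (scaleFreeFTRL D) vs
      ≤ inner ℝ vs.sum u + 5 / 2 * D * Real.sqrt (sumSq vs) := by
  have h1 := learnerLoss_le_ftrlObjective hD vs
  have h2 := ftrlObjective_ge hD vs hu
  have ha : 0 ≤ Real.sqrt (sumSq vs) := Real.sqrt_nonneg _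
  have h3 : Real.sqrt (sumSq vs) / (2 * D) * ‖u‖ ^ 2 ≤ 1 / 2 * D * Real.sqrt (sumSq vs) := by
    calc Real.sqrt (sumSq vs) / (2 * D) * ‖u‖ ^ 2 ≤ Real.sqrt (sumSq vs) / (2 * D) * D ^ 2 := by
          gcongr
      _ = _ := by field_simp
  have h4 : 0 ≤ Real.sqrt (sumSq vs) / (2 * D) * ‖u - scaleFreeFTRL D vs‖ ^ 2 := by positivity
  have h5 : ftrlObjective D vs u = inner ℝ vs.sum u + Real.sqrt (sumSq vs) / (2 * D) * ‖u‖ ^ 2 :=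
    rfl
  linarith

end Regret

/-! ### Discounted sums. -/

section DiscountedSum

variable {V : Type*} [AddCommGroup V] [Module ℝ V]

/-- The discounted sum `∑ s ∈ {1, …, t}, β ^ (t - s) • y s`. -/
noncomputable def discountedSum (β : ℝ) (y : ℕ → V) (t : ℕ) : V :=
  ∑ s ∈ Finset.Icc 1 t, β ^ (t - s) • y s

@[simp] theorem discountedSum_zero (β : ℝ) (y : ℕ → V) : discountedSum β y 0 = 0 := by
  simp [discountedSum]

theorem discountedSum_succ (β : ℝ) (y : ℕ → V) (t : ℕ) :
    discountedSum β y (t + 1) = β • discountedSum β y t + y (t + 1) := by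
  unfold discountedSum
  rw [Finset.sum_Icc_succ_top (by omega), Finset.smul_sum]
  congr 1
  · refine Finset.sum_congr rfl fun s hs => ?_
    have := (Finset.mem_Icc.1 hs).2
    rw [smul_smul, ← pow_succ', show t + 1 - s = t - s + 1 by omega]
  · simp

theorem discountedSum_add (β : ℝ) (y y' : ℕ → V) (t : ℕ) :
    discountedSum β (fun s => y s + y' s) t = discountedSum β y t + discountedSum β y' t := by
  simp [discountedSum, Finset.sum_add_distrib]

theorem discountedSum_sub (β : ℝ) (y y' : ℕ → V) (t : ℕ) :
    discountedSum β (fun s => y s - y' s) t = discountedSum β y t - discountedSum β y' t := by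
  simp [discountedSum, smul_sub]

theorem discountedSum_const {β : ℝ} (hβ : β ≠ 1) (c : ℝ) (t : ℕ) :
    discountedSum β (fun _ => c) t = (1 - β ^ t) / (1 - β) * c := by
  have : 1 - β ≠ 0 := sub_ne_zero.2 hβ.symm
  induction t with
  | zero => simp
  | succ t ih => rw [discountedSum_succ, ih, smul_eq_mul]; field_simp; ring

theorem sum_eq_discountedSum (β : ℝ) (y : ℕ → ℝ) (T : ℕ) :
    ∑ t ∈ Finset.Icc 1 T, y t
      = (1 - β) * ∑ t ∈ Finset.Icc 1 T, discountedSum β y t + β * discountedSum β y T := by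
  induction T with
  | zero => simp
  | succ T ih =>
    rw [Finset.sum_Icc_succ_top (by omega), Finset.sum_Icc_succ_top (by omega), ih,
      discountedSum_succ, smul_eq_mul]
    ring

/-- A truncation of `∑ k β^(k-1) = 1 / (1 - β)²`. The factor `1 - β ^ t` is kept because it cancels
the normalization of the discounted averages. -/
theorem discountedSum_age_le {β : ℝ} (hβ0 : 0 ≤ β) (hβ1 : β < 1) (t : ℕ) :
    discountedSum β (fun s => (t : ℝ) + 1 - s) t ≤ (1 - β ^ t) / (1 - β) ^ 2 := by
  have hp : 0 < 1 - β := by linarith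
  induction t with
  | zero => simp
  | succ t ih =>
    have h1 : discountedSum β (fun s => ((t + 1 : ℕ) : ℝ) + 1 - s) t
        = discountedSum β (fun s => (t : ℝ) + 1 - s) t + (1 - β ^ t) / (1 - β) := by
      rw [← mul_one ((1 - β ^ t) / (1 - β)), ← discountedSum_const hβ1.ne, ← discountedSum_add]
      congr 1; ext s; push_cast; ring
    rw [discountedSum_succ, h1, smul_eq_mul]
    push_cast
    have h2 := mul_le_mul_of_nonneg_left ih hβ0
    have h3 : β * ((1 - β ^ t) / (1 - β) ^ 2) + β * ((1 - β ^ t) / (1 - β)) + 1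
        ≤ (1 - β ^ (t + 1)) / (1 - β) ^ 2 := by
      rw [le_div_iff₀ (by positivity)]
      have : (β * ((1 - β ^ t) / (1 - β) ^ 2) + β * ((1 - β ^ t) / (1 - β)) + 1) * (1 - β) ^ 2
        = β * (1 - β ^ t) + β * (1 - β ^ t) * (1 - β) + (1 - β) ^ 2 := by field_simp
      rw [this, pow_succ β]
      nlinarith [mul_nonneg (mul_nonneg hβ0 hp.le) (pow_nonneg hβ0 t)]
    linarith

/-- A truncation of `∑ (k² + k) β^(k-1) = 2 / (1 - β)³`. The summand `k² + k` is the second moment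
of a sum of `k` independent `Exp(1)` variables, which controls the squared distance between iterates
`k` rounds apart. -/
theorem discountedSum_age_sq_le {β : ℝ} (hβ0 : 0 ≤ β) (hβ1 : β < 1) (t : ℕ) :
    discountedSum β (fun s => ((t : ℝ) + 1 - s) ^ 2 + ((t : ℝ) + 1 - s)) t
      ≤ 2 * (1 - β ^ t) / (1 - β) ^ 3 := by
  have hp : 0 < 1 - β := by linarith
  induction t with
  | zero => simp
  | succ t ih =>
    have h1 : discountedSum β
        (fun s => (((t + 1 : ℕ) : ℝ) + 1 - s) ^ 2 + (((t + 1 : ℕ) : ℝ) + 1 - s)) t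
        = discountedSum β (fun s => ((t : ℝ) + 1 - s) ^ 2 + ((t : ℝ) + 1 - s)) t
          + (discountedSum β (fun s => (t : ℝ) + 1 - s) t
          + (discountedSum β (fun s => (t : ℝ) + 1 - s) t + (1 - β ^ t) / (1 - β) * 2)) := by
      rw [← discountedSum_const hβ1.ne, ← discountedSum_add, ← discountedSum_add,
        ← discountedSum_add]
      congr 1; ext s; push_cast; ring
    rw [discountedSum_succ, h1, smul_eq_mul]
    push_cast
    have h2 := mul_le_mul_of_nonneg_left ih hβ0
    have h2' := mul_le_mul_of_nonneg_left (discountedSum_age_le hβ0 hβ1 t) hβ0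
    have h3 : β * (2 * (1 - β ^ t) / (1 - β) ^ 3) + 2 * (β * ((1 - β ^ t) / (1 - β) ^ 2))
          + β * ((1 - β ^ t) / (1 - β) * 2) + 2
        ≤ 2 * (1 - β ^ (t + 1)) / (1 - β) ^ 3 := by
      rw [le_div_iff₀ (by positivity)]
      have : (β * (2 * (1 - β ^ t) / (1 - β) ^ 3) + 2 * (β * ((1 - β ^ t) / (1 - β) ^ 2))
          + β * ((1 - β ^ t) / (1 - β) * 2) + 2) * (1 - β) ^ 3
        = β * (2 * (1 - β ^ t)) + 2 * (β * (1 - β ^ t)) * (1 - β)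
          + β * ((1 - β ^ t) * 2) * (1 - β) ^ 2 + 2 * (1 - β) ^ 3 := by field_simp
      rw [this, pow_succ β]
      nlinarith [mul_nonneg (mul_nonneg hβ0 hp.le) (pow_nonneg hβ0 t),
        mul_nonneg (mul_nonneg hβ0 (sq_nonneg (1 - β))) (pow_nonneg hβ0 t),
        mul_nonneg (mul_nonneg hβ0 (mul_nonneg hp.le hp.le)) (pow_nonneg hβ0 t)]
    nlinarith [h2, h2', h3]

end DiscountedSum

/-! ### Discounted means and variances. -/

section Average

variable {E : Type*} [NormedAddCommGroup E] [InnerProductSpace ℝ E]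

theorem sum_norm_sub_sq {ι : Type*} (I : Finset ι) (w : ι → ℝ) (x : ι → E) (m : E)
    (hw : ∑ i ∈ I, w i = 1) (hm : ∑ i ∈ I, w i • x i = m) (c : E) :
    ∑ i ∈ I, w i * ‖x i - c‖ ^ 2 = ∑ i ∈ I, w i * ‖x i - m‖ ^ 2 + ‖m - c‖ ^ 2 := by
  have h1 : ∀ i, w i * ‖x i - c‖ ^ 2
      = w i * ‖x i - m‖ ^ 2 + (2 * inner ℝ (w i • (x i - m)) (m - c) + w i * ‖m - c‖ ^ 2) := by
    intro i
    rw [← sub_add_sub_cancel (x i) m c, norm_add_sq_real, inner_smul_left]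
    simp only [conj_trivial]; ring
  rw [Finset.sum_congr rfl fun i _ => h1 i, Finset.sum_add_distrib, Finset.sum_add_distrib,
    ← Finset.mul_sum, ← sum_inner, ← Finset.sum_mul, hw]
  have h2 : ∑ i ∈ I, w i • (x i - m) = 0 := by
    simp [smul_sub, Finset.sum_sub_distrib, hm, ← Finset.sum_smul, hw]
  simp [h2]

/-- The discounted average of `y 1, …, y t`. -/
noncomputable def discountedMean (β : ℝ) (y : ℕ → E) (t : ℕ) : E :=
  ((1 - β) / (1 - β ^ t)) • discountedSum β y t

/-- The discounted variance of `y 1, …, y t`. -/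
noncomputable def discountedVariance (β : ℝ) (y : ℕ → E) (t : ℕ) : ℝ :=
  (1 - β) / (1 - β ^ t) * discountedSum β (fun s => ‖y s - discountedMean β y t‖ ^ 2) t

theorem one_sub_pow_pos {β : ℝ} (hβ0 : 0 ≤ β) (hβ1 : β < 1) {t : ℕ} (ht : 1 ≤ t) :
    0 < 1 - β ^ t := by
  have := pow_lt_one₀ hβ0 hβ1 (n := t) (by omega)
  linarith

theorem discountedWeights_sum {β : ℝ} (hβ0 : 0 ≤ β) (hβ1 : β < 1) {t : ℕ} (ht : 1 ≤ t) :
    ∑ s ∈ Finset.Icc 1 t, (1 - β) / (1 - β ^ t) * β ^ (t - s) = 1 := by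
  have h1 := discountedSum_const hβ1.ne 1 t
  simp only [discountedSum, smul_eq_mul, mul_one] at h1
  have := one_sub_pow_pos hβ0 hβ1 ht
  have : 1 - β ≠ 0 := by linarith
  rw [← Finset.mul_sum, h1]; field_simp

theorem discountedMean_eq_sum (β : ℝ) (y : ℕ → E) (t : ℕ) :
    discountedMean β y t = ∑ s ∈ Finset.Icc 1 t, ((1 - β) / (1 - β ^ t) * β ^ (t - s)) • y s := by
  simp [discountedMean, discountedSum, Finset.smul_sum, smul_smul]

theorem discountedVariance_eq_sum (β : ℝ) (y : ℕ → E) (t : ℕ) :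
    discountedVariance β y t = ∑ s ∈ Finset.Icc 1 t,
      (1 - β) / (1 - β ^ t) * β ^ (t - s) * ‖y s - discountedMean β y t‖ ^ 2 := by
  simp [discountedVariance, discountedSum, Finset.mul_sum, mul_assoc]

theorem discountedMean_succ {β : ℝ} (hβ0 : 0 ≤ β) (hβ1 : β < 1) (y : ℕ → E) (t : ℕ) :
    discountedMean β y (t + 1) = ((β - β ^ (t + 1)) / (1 - β ^ (t + 1))) • discountedMean β y t
      + ((1 - β) / (1 - β ^ (t + 1))) • y (t + 1) := by
  unfold discountedMean
  rw [discountedSum_succ, smul_add, smul_smul, smul_smul]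
  congr 1
  -- For `t = 0` the normalizer `1 - β ^ 0` vanishes, but so does the discounted sum.
  rcases Nat.eq_zero_or_pos t with rfl | ht
  · simp
  congr 1
  have h1 := one_sub_pow_pos hβ0 hβ1 ht
  have h2 := one_sub_pow_pos hβ0 hβ1 (t := t + 1) (by omega)
  rw [pow_succ] at *
  field_simp

theorem discountedVariance_one {β : ℝ} (hβ1 : β < 1) (y : ℕ → E) :
    discountedVariance β y 1 = 0 := by
  have : 1 - β ≠ 0 := by linarith
  simp [discountedVariance, discountedMean, discountedSum, div_self this]

/-- With `γ` the weight of the new point, the parallel-axis identity `sum_norm_sub_sq` is used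
twice: about the old mean for the new weights, and about the new point for the old weights.
Eliminating the distance from the new point to the old mean leaves only pairwise distances, which
the step sizes control. -/
theorem discountedVariance_succ {β : ℝ} (hβ0 : 0 ≤ β) (hβ1 : β < 1) (y : ℕ → E) {t : ℕ}
    (ht : 1 ≤ t) :
    discountedVariance β y (t + 1)
      = ((β - β ^ (t + 1)) / (1 - β ^ (t + 1))) ^ 2 * discountedVariance β y t
        + (1 - β) / (1 - β ^ (t + 1)) * ((β - β ^ (t + 1)) / (1 - β ^ (t + 1)))
          * ((1 - β) / (1 - β ^ t) * discountedSum β (fun s => ‖y (t + 1) - y s‖ ^ 2) t) := by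
  have h1 := one_sub_pow_pos hβ0 hβ1 ht
  have h2 := one_sub_pow_pos hβ0 hβ1 (t := t + 1) (by omega)
  have hp : 0 < 1 - β := by linarith
  set γ := (1 - β) / (1 - β ^ (t + 1)) with hγ
  have hγ' : (β - β ^ (t + 1)) / (1 - β ^ (t + 1)) = 1 - γ := by rw [hγ]; field_simp; ring
  have hγ3 : γ * β = (1 - γ) * ((1 - β) / (1 - β ^ t)) := by
    rw [← hγ', hγ, pow_succ] at *; field_simp
  set m := discountedMean β y t with hm
  have hm' := discountedMean_succ hβ0 hβ1 y t
  rw [← hm, hγ', ← hγ] at hm'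
  have e1 := sum_norm_sub_sq (Finset.Icc 1 t) _ y m (discountedWeights_sum hβ0 hβ1 ht)
    (discountedMean_eq_sum β y t).symm (y (t + 1))
  have e2 := sum_norm_sub_sq (Finset.Icc 1 (t + 1)) _ y _
    (discountedWeights_sum hβ0 hβ1 (t := t + 1) (by omega))
    (discountedMean_eq_sum β y (t + 1)).symm m
  have e3 : ∑ s ∈ Finset.Icc 1 (t + 1), γ * β ^ (t + 1 - s) * ‖y s - m‖ ^ 2
      = (1 - γ) * discountedVariance β y t + γ * ‖y (t + 1) - m‖ ^ 2 := by
    have := discountedSum_succ β (fun s => ‖y s - m‖ ^ 2) t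
    rw [discountedVariance, ← hm, ← mul_assoc, ← hγ3, mul_assoc, ← mul_add, ← smul_eq_mul β, ← this,
      discountedSum, Finset.mul_sum]
    simp [mul_assoc]
  rw [← discountedVariance_eq_sum] at e1 e2
  have e4 : ‖discountedMean β y (t + 1) - m‖ ^ 2 = γ ^ 2 * ‖y (t + 1) - m‖ ^ 2 := by
    rw [hm', sub_smul, one_smul, show m - γ • m + γ • y (t + 1) - m = γ • (y (t + 1) - m) by
      rw [smul_sub]; abel, norm_smul, mul_pow, Real.norm_eq_abs, sq_abs]
  have e5 : (1 - β) / (1 - β ^ t) * discountedSum β (fun s => ‖y (t + 1) - y s‖ ^ 2) t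
      = ∑ s ∈ Finset.Icc 1 t, (1 - β) / (1 - β ^ t) * β ^ (t - s) * ‖y s - y (t + 1)‖ ^ 2 := by
    simp [discountedSum, Finset.mul_sum, mul_assoc, norm_sub_rev]
  rw [e3, e4] at e2
  rw [e5, e1, hγ', norm_sub_rev m]
  linear_combination -e2

end Average

/-! ### Deterministic analysis of the conversion. -/

section Conversion

variable {E Z : Type*} [NormedAddCommGroup E] [InnerProductSpace ℝ E]
  (stoGrad : E → Z → E) (A : OnlineLearner E) (β : ℝ) (x₀ : E) (a : ℕ → ℝ) (r : ℕ → Z)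

/-- The iterates `x_t` of the conversion. -/
noncomputable def iterate (t : ℕ) : E := (conversion stoGrad A β x₀ a r t).x

/-- The decision `z_{t+1}` of the learner after round `t` of the conversion. -/
noncomputable def decision (t : ℕ) : E := A (conversion stoGrad A β x₀ a r t).losses

/-- The stochastic gradients `g_t` of the conversion. -/
noncomputable def oracleGrad (t : ℕ) : E := stoGrad (iterate stoGrad A β x₀ a r t) (r t)

theorem losses_succ (t : ℕ) : (conversion stoGrad A β x₀ a r (t + 1)).losses
    = (β ^ (t + 1))⁻¹ • oracleGrad stoGrad A β x₀ a r (t + 1)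
      :: (conversion stoGrad A β x₀ a r t).losses := rfl

theorem xbar_eq_discountedMean (hβ0 : 0 ≤ β) (hβ1 : β < 1) {t : ℕ} (ht : 1 ≤ t) :
    (conversion stoGrad A β x₀ a r t).xbar
      = discountedMean β (iterate stoGrad A β x₀ a r) t := by
  induction t, ht using Nat.le_induction with
  -- The identity starts at `t = 1`: at `t = 0` the EMA is `x₀` while the discounted mean is `0`.
  | base =>
    have : 1 - β ≠ 0 := by linarith
    simp [conversion, conversionStep, discountedMean, discountedSum, iterate, div_self this]
  | succ t ht ih =>
    rw [discountedMean_succ hβ0 hβ1, ← ih]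
    rfl

theorem sum_losses (hβ : β ≠ 0) (t : ℕ) :
    β ^ t • (conversion stoGrad A β x₀ a r t).losses.sum
      = discountedSum β (oracleGrad stoGrad A β x₀ a r) t := by
  induction t with
  | zero => simp [conversion]
  | succ t ih =>
    rw [losses_succ, discountedSum_succ, ← ih, List.sum_cons, smul_add, smul_smul, smul_smul,
      mul_inv_cancel₀ (pow_ne_zero _ hβ), one_smul, pow_succ', add_comm]

/-- Squaring the weights `β ^ (-s)` turns the discount factor `β` into `β ^ 2`. -/
theorem sumSq_losses (hβ : β ≠ 0) (t : ℕ) :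
    (β ^ t) ^ 2 * sumSq (conversion stoGrad A β x₀ a r t).losses
      = discountedSum (β ^ 2) (fun s => ‖oracleGrad stoGrad A β x₀ a r s‖ ^ 2) t := by
  induction t with
  | zero => simp [conversion, sumSq]
  | succ t ih =>
    have := pow_ne_zero (t + 1) hβ
    rw [losses_succ, discountedSum_succ, ← ih, sumSq_cons, norm_smul, mul_pow, norm_inv, inv_pow,
      Real.norm_eq_abs, sq_abs, smul_eq_mul]
    field_simp
    ring

/-- Decisions are indexed by the number of rounds already played, so `g_s` is paired with index `s -
1`; the truncated subtraction is harmless since `s ≥ 1`. -/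
theorem learnerLoss_losses (hβ : β ≠ 0) (t : ℕ) :
    β ^ t * learnerLoss A (conversion stoGrad A β x₀ a r t).losses
      = discountedSum β (fun s => inner ℝ (oracleGrad stoGrad A β x₀ a r s)
          (decision stoGrad A β x₀ a r (s - 1))) t := by
  induction t with
  | zero => simp [conversion, learnerLoss]
  | succ t ih =>
    have := pow_ne_zero (t + 1) hβ
    rw [losses_succ, discountedSum_succ, ← ih, learnerLoss, inner_smul_left, smul_eq_mul]
    simp only [conj_trivial, Nat.add_sub_cancel, decision]
    field_simp
    ring

/-- The discounted regret of `β`-FTRL along the conversion. -/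
theorem discounted_regret_le {D : ℝ} (hD : 0 < D) (hβ : 0 < β) (t : ℕ) {u : E} (hu : ‖u‖ ≤ D) :
    discountedSum β (fun s => inner ℝ (oracleGrad stoGrad (scaleFreeFTRL D) β x₀ a r s)
          (decision stoGrad (scaleFreeFTRL D) β x₀ a r (s - 1))) t
      ≤ inner ℝ (discountedSum β (oracleGrad stoGrad (scaleFreeFTRL D) β x₀ a r) t) u
        + 5 / 2 * D * Real.sqrt (discountedSum (β ^ 2)
          (fun s => ‖oracleGrad stoGrad (scaleFreeFTRL D) β x₀ a r s‖ ^ 2) t) := by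
  have hb : 0 < β ^ t := pow_pos hβ t
  rw [← learnerLoss_losses _ _ _ _ _ _ hβ.ne', ← sum_losses _ _ _ _ _ _ hβ.ne',
    ← sumSq_losses _ _ _ _ _ _ hβ.ne', Real.sqrt_mul (sq_nonneg _), Real.sqrt_sq hb.le,
    inner_smul_left]
  have := mul_le_mul_of_nonneg_left
    (learnerLoss_scaleFreeFTRL_le hD (conversion stoGrad (scaleFreeFTRL D) β x₀ a r t).losses hu)
    hb.le
  simp only [conj_trivial]
  linarith

/-- The discounted loss of `β`-FTRL against the comparator that points against the discounted sum of
vectors `h s`, of which the stochastic gradients are perturbations. -/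
theorem discounted_loss_le {D : ℝ} (hD : 0 < D) (hβ : 0 < β) (t : ℕ) (h : ℕ → E) :
    discountedSum β (fun s => inner ℝ (oracleGrad stoGrad (scaleFreeFTRL D) β x₀ a r s)
          (decision stoGrad (scaleFreeFTRL D) β x₀ a r (s - 1))) t
      ≤ -D * ‖discountedSum β h t‖
        + D * ‖discountedSum β
            (fun s => oracleGrad stoGrad (scaleFreeFTRL D) β x₀ a r s - h s) t‖
        + 5 / 2 * D * Real.sqrt (discountedSum (β ^ 2)
          (fun s => ‖oracleGrad stoGrad (scaleFreeFTRL D) β x₀ a r s‖ ^ 2) t) := by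
  rw [discountedSum_sub]
  set H := discountedSum β h t
  obtain ⟨u, hu, huH⟩ : ∃ u : E, ‖u‖ ≤ D ∧ inner ℝ H u = -D * ‖H‖ := by
    rcases eq_or_ne H 0 with h0 | h0
    · exact ⟨0, by simpa using hD.le, by simp [h0]⟩
    · have hn : 0 < ‖H‖ := norm_pos_iff.2 h0
      refine ⟨-(D / ‖H‖) • H, ?_, ?_⟩
      · rw [norm_smul, norm_neg, Real.norm_of_nonneg (by positivity), div_mul_cancel₀ _ hn.ne']
      · rw [inner_smul_right, real_inner_self_eq_norm_sq]; field_simp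
  have h1 := discounted_regret_le stoGrad β x₀ a r hD hβ t hu
  set g := discountedSum β (oracleGrad stoGrad (scaleFreeFTRL D) β x₀ a r) t
  have h2 : inner ℝ (g - H) u ≤ D * ‖g - H‖ :=
    (real_inner_le_norm _ _).trans (by rw [mul_comm]; gcongr)
  rw [inner_sub_left, huH] at h2
  linarith

end Conversion

/-! ### Mixtures of Dirac masses. -/

section Mixture

variable {E V : Type*} [MeasurableSpace E] [MeasurableSingletonClass E] [NormedAddCommGroup V]

theorem integrable_smul_dirac (c : ℝ) (x : E) (f : E → V) :
    Integrable f (ENNReal.ofReal c • Measure.dirac x) :=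
  (integrable_dirac (by simp)).smul_measure ENNReal.ofReal_ne_top

theorem integrable_sum_smul_dirac {ι : Type*} (I : Finset ι) (w : ι → ℝ) (x : ι → E) (f : E → V) :
    Integrable f (∑ i ∈ I, ENNReal.ofReal (w i) • Measure.dirac (x i)) :=
  integrable_finsetSum_measure.2 fun _ _ => integrable_smul_dirac _ _ f

variable [NormedSpace ℝ V] [CompleteSpace V]

theorem integral_smul_dirac {c : ℝ} (hc : 0 ≤ c) (x : E) (f : E → V) :
    ∫ y, f y ∂(ENNReal.ofReal c • Measure.dirac x) = c • f x := by
  rw [integral_smul_measure, integral_dirac, ENNReal.toReal_ofReal hc]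

theorem integral_sum_smul_dirac {ι : Type*} (I : Finset ι) (w : ι → ℝ) (x : ι → E)
    (hw : ∀ i ∈ I, 0 ≤ w i) (f : E → V) :
    ∫ y, f y ∂(∑ i ∈ I, ENNReal.ofReal (w i) • Measure.dirac (x i))
      = ∑ i ∈ I, w i • f (x i) := by
  rw [integral_finsetSum_measure fun i _ => integrable_smul_dirac _ _ f]
  exact Finset.sum_congr rfl fun i hi => integral_smul_dirac (hw i hi) _ _

theorem integral_mixture_dirac {a b : ℝ} (ha : 0 ≤ a) (hb : 0 ≤ b) (p : Measure E) (x : E)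
    {f : E → V} (hf : Integrable f p) :
    Integrable f (ENNReal.ofReal a • p + ENNReal.ofReal b • Measure.dirac x) ∧
    ∫ y, f y ∂(ENNReal.ofReal a • p + ENNReal.ofReal b • Measure.dirac x)
      = a • ∫ y, f y ∂p + b • f x := by
  have h1 := hf.smul_measure (c := ENNReal.ofReal a) ENNReal.ofReal_ne_top
  refine ⟨h1.add_measure (integrable_smul_dirac _ _ f), ?_⟩
  rw [integral_add_measure h1 (integrable_smul_dirac _ _ f), integral_smul_measure,
    integral_smul_dirac hb, ENNReal.toReal_ofReal ha]

end Mixture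

/-! ### The regularized gradient norm: upper bounds and continuity. -/

section RegGradNorm

variable {E : Type*} [NormedAddCommGroup E] [InnerProductSpace ℝ E] [CompleteSpace E]
  [MeasurableSpace E]

theorem regGradNorm_le {lam : ℝ} (hlam : 0 ≤ lam) (F : E → ℝ) {x : E} {c : ℝ} (p : Measure E)
    [IsProbabilityMeasure p] (h1 : Integrable (fun y => y) p) (h2 : ∫ y, y ∂p = x)
    (h3 : Integrable (fun y => gradient F y) p) (h4 : Integrable (fun y => ‖y - x‖ ^ 2) p)
    (hc : ‖∫ y, gradient F y ∂p‖ + lam * ∫ y, ‖y - x‖ ^ 2 ∂p ≤ c) : regGradNorm lam F x ≤ c := by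
  unfold regGradNorm
  refine le_trans (csInf_le ⟨0, ?_⟩ ⟨p, inferInstance, h1, h2, h3, h4, rfl⟩) hc
  rintro _ ⟨q, -, -, -, -, -, rfl⟩
  have : 0 ≤ ∫ y, ‖y - x‖ ^ 2 ∂q := integral_nonneg fun y => by positivity
  positivity

theorem regGradNorm_nonneg {lam : ℝ} (hlam : 0 ≤ lam) (F : E → ℝ) (x : E) :
    0 ≤ regGradNorm lam F x := by
  refine Real.sInf_nonneg ?_
  rintro _ ⟨q, -, -, -, -, -, rfl⟩
  have : 0 ≤ ∫ y, ‖y - x‖ ^ 2 ∂q := integral_nonneg fun y => by positivity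
  positivity

theorem integral_norm_sub_sq [OpensMeasurableSpace E] (p : Measure E) [IsProbabilityMeasure p]
    {x : E} (h1 : Integrable (fun y => y) p) (h2 : ∫ y, y ∂p = x)
    (h4 : Integrable (fun y => ‖y - x‖ ^ 2) p) (c : E) :
    Integrable (fun y => ‖y - c‖ ^ 2) p ∧
      ∫ y, ‖y - c‖ ^ 2 ∂p = ∫ y, ‖y - x‖ ^ 2 ∂p + ‖x - c‖ ^ 2 := by
  have h5 : ∀ y, ‖y - c‖ ^ 2 = ‖y - x‖ ^ 2 + (2 * inner ℝ (x - c) (y - x) + ‖x - c‖ ^ 2) := by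
    intro y
    rw [← sub_add_sub_cancel y x c, norm_add_sq_real, real_inner_comm]; ring
  have h6 : Integrable (fun y => y - x) p := h1.sub (integrable_const x)
  have h7 : Integrable (fun y => 2 * inner ℝ (x - c) (y - x)) p := (h6.const_inner _).const_mul 2
  have h8 : ∫ y, inner ℝ (x - c) (y - x) ∂p = 0 := by
    rw [integral_inner h6, integral_sub h1 (integrable_const x), h2]
    simp
  rw [show (fun y => ‖y - c‖ ^ 2) = _ from funext h5]
  constructor
  · exact h4.add (h7.add (integrable_const _))
  · have h9 : Integrable (fun y => 2 * inner ℝ (x - c) (y - x) + ‖x - c‖ ^ 2) p :=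
      h7.add (integrable_const _)
    rw [integral_add h4 h9, integral_add h7 (integrable_const _),
      integral_const_mul, h8]
    simp

variable [MeasurableSingletonClass E]

/-- The regularized gradient norm is bounded by its objective at a finitely supported measure. -/
theorem regGradNorm_le_sum {lam : ℝ} (hlam : 0 ≤ lam) (F : E → ℝ) {ι : Type*} (I : Finset ι)
    (w : ι → ℝ) (x : ι → E) (m : E) (hw0 : ∀ i ∈ I, 0 ≤ w i) (hw : ∑ i ∈ I, w i = 1)
    (hm : ∑ i ∈ I, w i • x i = m) :
    regGradNorm lam F m
      ≤ ‖∑ i ∈ I, w i • gradient F (x i)‖ + lam * ∑ i ∈ I, w i * ‖x i - m‖ ^ 2 := by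
  set p : Measure E := ∑ i ∈ I, ENNReal.ofReal (w i) • Measure.dirac (x i) with hp
  have : IsProbabilityMeasure p := by
    constructor
    simp only [hp, Measure.coe_finsetSum, Finset.sum_apply, Measure.smul_apply, measure_univ,
      smul_eq_mul, mul_one]
    rw [← ENNReal.ofReal_sum_of_nonneg hw0, hw, ENNReal.ofReal_one]
  refine regGradNorm_le hlam F p (integrable_sum_smul_dirac _ _ _ _)
    ((integral_sum_smul_dirac I w x hw0 _).trans hm) (integrable_sum_smul_dirac _ _ _ _)
    (integrable_sum_smul_dirac _ _ _ _) ?_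
  rw [integral_sum_smul_dirac I w x hw0, integral_sum_smul_dirac I w x hw0]
  simp

theorem regGradNorm_le_norm_gradient {lam : ℝ} (hlam : 0 ≤ lam) (F : E → ℝ) (x : E) :
    regGradNorm lam F x ≤ ‖gradient F x‖ := by
  simpa using regGradNorm_le_sum hlam F ({()} : Finset Unit) (fun _ => 1) (fun _ => x) x
    (by simp) (by simp) (by simp)

theorem regGradNorm_discountedMean_le {lam : ℝ} (hlam : 0 ≤ lam) (F : E → ℝ) {β : ℝ} (hβ0 : 0 ≤ β)
    (hβ1 : β < 1) (x : ℕ → E) {t : ℕ} (ht : 1 ≤ t) :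
    regGradNorm lam F (discountedMean β x t)
      ≤ ‖discountedMean β (fun s => gradient F (x s)) t‖ + lam * discountedVariance β x t := by
  rw [discountedVariance_eq_sum, discountedMean_eq_sum β fun s => gradient F (x s)]
  refine regGradNorm_le_sum hlam F _ _ x _ (fun s _ => ?_) (discountedWeights_sum hβ0 hβ1 ht)
    (discountedMean_eq_sum β x t).symm
  have := one_sub_pow_pos hβ0 hβ1 ht
  have := pow_nonneg hβ0 (t - s)
  have : 0 < 1 - β := by linarith
  positivity

/-- Translating a competitor `p` from `x` to `x'` could change the mean gradient uncontrollably,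
since `∇F` need not be continuous. Instead `p` is mixed with a Dirac mass of small weight `δ`, which
moves the mean gradient by a controlled amount. -/
theorem regGradNorm_le_add [OpensMeasurableSpace E] {lam G : ℝ} (hlam : 0 ≤ lam) (F : E → ℝ)
    (hG : ∀ x, ‖gradient F x‖ ≤ G) (x x' : E) (hxx : ‖x' - x‖ ≤ 1) :
    regGradNorm lam F x' ≤ regGradNorm lam F x + (G + lam) * ‖x' - x‖ := by
  rcases eq_or_ne x' x with rfl | hne
  · simp
  set δ := ‖x' - x‖ with hδ
  have hδ0 : 0 < δ := norm_pos_iff.2 (sub_ne_zero.2 hne)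
  rw [← sub_le_iff_le_add]
  refine le_csInf ⟨_, Measure.dirac x, inferInstance, integrable_dirac (by simp),
    integral_dirac _ _, integrable_dirac (by simp), integrable_dirac (by simp), rfl⟩ ?_
  rintro _ ⟨p, hp, h1, h2, h3, h4, rfl⟩
  rw [sub_le_iff_le_add]
  -- The point at distance `1` from `x` in the direction of `x'`: with weight `δ` it shifts the mean
  -- by exactly `x' - x`.
  set q : E := x + δ⁻¹ • (x' - x) with hq
  set p' : Measure E := ENNReal.ofReal (1 - δ) • p + ENNReal.ofReal δ • Measure.dirac q with hp'
  have hδ1 : 0 ≤ 1 - δ := by linarith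
  have : IsProbabilityMeasure p' := by
    constructor
    simp only [hp', Measure.coe_add, Pi.add_apply, Measure.smul_apply, measure_univ,
      smul_eq_mul, mul_one]
    rw [← ENNReal.ofReal_add (by linarith) hδ0.le]
    simp
  obtain ⟨h5, h6⟩ := integral_norm_sub_sq p h1 h2 h4 x'
  obtain ⟨i1, v1⟩ := integral_mixture_dirac hδ1 hδ0.le p q h1
  obtain ⟨i3, v3⟩ := integral_mixture_dirac hδ1 hδ0.le p q h3
  obtain ⟨i5, v5⟩ := integral_mixture_dirac hδ1 hδ0.le p q h5
  refine regGradNorm_le hlam F p' i1 ?_ i3 i5 ?_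
  · rw [v1, h2, hq, smul_add, smul_smul, mul_inv_cancel₀ hδ0.ne', sub_smul, one_smul, one_smul]
    abel
  · rw [v3, v5, h6, norm_sub_rev x x', ← hδ]
    have e1 : ‖q - x'‖ = 1 - δ := by
      have : q - x' = (δ⁻¹ - 1) • (x' - x) := by rw [hq, sub_smul, one_smul]; abel
      rw [this, norm_smul, ← hδ, Real.norm_of_nonneg (sub_nonneg.2 ((one_le_inv₀ hδ0).2 hxx)),
        sub_mul, inv_mul_cancel₀ hδ0.ne', one_mul]
    rw [e1]
    have e2 : ‖(1 - δ) • ∫ y, gradient F y ∂p + δ • gradient F q‖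
        ≤ ‖∫ y, gradient F y ∂p‖ + δ * G := by
      refine (norm_add_le _ _).trans (add_le_add ?_ ?_)
      · rw [norm_smul, Real.norm_of_nonneg (by linarith)]
        exact mul_le_of_le_one_left (norm_nonneg _) (by linarith)
      · rw [norm_smul, Real.norm_of_nonneg hδ0.le]
        exact mul_le_mul_of_nonneg_left (hG q) hδ0.le
    have hV : 0 ≤ ∫ y, ‖y - x‖ ^ 2 ∂p := integral_nonneg fun y => by positivity
    set V := ∫ y, ‖y - x‖ ^ 2 ∂p
    have e3 : (1 - δ) • (V + δ ^ 2) + δ • (1 - δ) ^ 2 ≤ V + δ := by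
      simp only [smul_eq_mul]
      nlinarith [mul_nonneg hδ0.le hV, mul_nonneg hδ0.le hδ0.le]
    nlinarith [mul_le_mul_of_nonneg_left e3 hlam]

theorem continuous_regGradNorm [OpensMeasurableSpace E] {lam G : ℝ} (hlam : 0 ≤ lam) (F : E → ℝ)
    (hG : ∀ x, ‖gradient F x‖ ≤ G) : Continuous (regGradNorm lam F) := by
  have hG0 : 0 ≤ G := (norm_nonneg _).trans (hG 0)
  rw [Metric.continuous_iff]
  intro x ε hε
  refine ⟨min 1 (ε / (G + lam + 1)), by positivity, fun y hy => ?_⟩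
  rw [dist_eq_norm] at hy
  have h1 := regGradNorm_le_add hlam F hG x y (hy.le.trans (min_le_left _ _))
  have h2 := regGradNorm_le_add hlam F hG y x
    (by rw [norm_sub_rev]; exact hy.le.trans (min_le_left _ _))
  rw [norm_sub_rev x y] at h2
  have h3 : (G + lam + 1) * ‖y - x‖ < ε := by
    have := hy.trans_le (min_le_right _ _)
    rwa [lt_div_iff₀ (by positivity), mul_comm] at this
  rw [Real.dist_eq, abs_lt]
  constructor <;> nlinarith [norm_nonneg (y - x)]

end RegGradNorm

/-! ### Measurability of the gradient and derivatives along lines. -/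

section Gradient

variable {E : Type*} [NormedAddCommGroup E] [InnerProductSpace ℝ E] [CompleteSpace E]

theorem measurable_gradient [MeasurableSpace E] [BorelSpace E] [SecondCountableTopology E]
    (F : E → ℝ) : Measurable (gradient F) := by
  have h : Measurable fun x => fderiv ℝ F x := measurable_fderiv ℝ F
  exact (InnerProductSpace.toDual ℝ E).symm.continuous.measurable.comp h

theorem abs_sub_le_of_norm_gradient_le {F : E → ℝ} {G : ℝ} (hF : Differentiable ℝ F)
    (hG : ∀ x, ‖gradient F x‖ ≤ G) (x y : E) : |F y - F x| ≤ G * ‖y - x‖ := by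
  refine (convex_univ).norm_image_sub_le_of_norm_fderiv_le (𝕜 := ℝ) (fun z _ => hF z)
    (fun z _ => ?_) (Set.mem_univ x) (Set.mem_univ y)
  rw [← toDual_gradient, LinearIsometryEquiv.norm_map]
  exact hG z

theorem hasDerivAt_comp_line {F : E → ℝ} (hF : Differentiable ℝ F) (x z : E) (a : ℝ) :
    HasDerivAt (fun a => F (x + a • z)) (inner ℝ (gradient F (x + a • z)) z) a := by
  have h1 := (hF (x + a • z)).hasGradientAt.hasFDerivAt
  have h2 : HasDerivAt (fun a : ℝ => x + a • z) z a := by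
    simpa using ((hasDerivAt_id a).smul_const z).const_add x
  simpa using! h1.comp_hasDerivAt a h2

end Gradient

/-! ### The exponential law. -/

section Exponential

theorem expMeasure_one_eq :
    expMeasure 1 = (volume.restrict (Set.Ioi 0)).withDensity
      (fun x => ENNReal.ofReal (Real.exp (-x))) := by
  have h : gammaPDF 1 1 =ᵐ[volume]
      (Set.Ioi (0 : ℝ)).indicator fun x => ENNReal.ofReal (Real.exp (-x)) := by
    have : ∀ᵐ x : ℝ, x ≠ 0 := by simp [ae_iff]
    filter_upwards [this] with x hx
    rcases lt_or_gt_of_ne hx with h | h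
    · rw [gammaPDF_of_neg h, Set.indicator_of_notMem (by simpa using h.le)]
    · rw [gammaPDF_of_nonneg h.le, Set.indicator_of_mem (by simpa using h)]
      simp
  rw [expMeasure, gammaMeasure, withDensity_congr_ae h, withDensity_indicator measurableSet_Ioi]

theorem integral_expMeasure_one (f : ℝ → ℝ) :
    ∫ a, f a ∂(expMeasure 1) = ∫ a in Set.Ioi 0, Real.exp (-a) * f a := by
  rw [expMeasure_one_eq, integral_withDensity_eq_integral_toReal_smul (by fun_prop)
    (by simp)]
  simp [ENNReal.toReal_ofReal, Real.exp_nonneg]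

theorem integrable_expMeasure_one_iff (f : ℝ → ℝ) :
    Integrable f (expMeasure 1) ↔ IntegrableOn (fun a => Real.exp (-a) * f a) (Set.Ioi 0) := by
  rw [expMeasure_one_eq, integrable_withDensity_iff_integrable_smul' (by fun_prop) (by simp)]
  simp [ENNReal.toReal_ofReal, Real.exp_nonneg, IntegrableOn]

theorem integrable_rpow_expMeasure_one {s : ℝ} (hs : 0 < s) :
    Integrable (fun a => a ^ (s - 1)) (expMeasure 1) :=
  (integrable_expMeasure_one_iff _).2 (Real.GammaIntegral_convergent hs)

theorem integral_rpow_expMeasure_one {s : ℝ} (hs : 0 < s) :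
    ∫ a, a ^ (s - 1) ∂(expMeasure 1) = Real.Gamma s := by
  rw [integral_expMeasure_one, Real.Gamma_eq_integral hs]

theorem integrable_id_expMeasure_one : Integrable (fun a : ℝ => a) (expMeasure 1) := by
  have h := integrable_rpow_expMeasure_one (s := 2) (by norm_num)
  norm_num at h
  exact h

theorem integrable_sq_expMeasure_one : Integrable (fun a : ℝ => a ^ 2) (expMeasure 1) := by
  have h := integrable_rpow_expMeasure_one (s := 3) (by norm_num)
  norm_num at h
  exact h

theorem integral_id_expMeasure_one : ∫ a : ℝ, a ∂(expMeasure 1) = 1 := by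
  have h := integral_rpow_expMeasure_one (s := 2) (by norm_num)
  norm_num at h
  exact h

theorem integral_sq_expMeasure_one : ∫ a : ℝ, a ^ 2 ∂(expMeasure 1) = 2 := by
  have h := integral_rpow_expMeasure_one (s := 3) (by norm_num)
  have h3 : Real.Gamma 3 = 2 := by
    rw [show (3 : ℝ) = (2 : ℕ) + 1 by norm_num, Real.Gamma_nat_eq_factorial]; norm_num
  norm_num [h3] at h
  exact h

theorem ae_nonneg_expMeasure_one : ∀ᵐ a ∂(expMeasure 1), 0 ≤ a := by
  rw [expMeasure_one_eq]
  refine (withDensity_absolutelyContinuous _ _).ae_le ?_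
  filter_upwards [ae_restrict_mem measurableSet_Ioi] with a ha using le_of_lt ha

/-- An exponentially distributed step turns the expected increment of a function into an expected
derivative. -/
theorem integral_sub_eq_integral_deriv_expMeasure_one {φ φ' : ℝ → ℝ} {M : ℝ}
    (hφ : ∀ a, HasDerivAt φ (φ' a) a) (hM : ∀ a, |φ' a| ≤ M)
    (hlip : ∀ a, |φ a - φ 0| ≤ M * |a|) :
    ∫ a, (φ a - φ 0) ∂(expMeasure 1) = ∫ a, φ' a ∂(expMeasure 1) := by
  have : IsProbabilityMeasure (expMeasure 1) := isProbabilityMeasure_expMeasure one_pos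
  have hcont : Continuous φ := continuous_iff_continuousAt.2 fun a => (hφ a).continuousAt
  have hmeas' : Measurable φ' := by
    rw [show φ' = deriv φ from funext fun a => (hφ a).deriv.symm]
    exact measurable_deriv φ
  have i1 : Integrable (fun a => φ a - φ 0) (expMeasure 1) :=
    (integrable_id_expMeasure_one.norm.const_mul M).mono'
      (by fun_prop) (ae_of_all _ fun a => hlip a)
  have i2 : Integrable φ' (expMeasure 1) :=
    (integrable_const M).mono' (by fun_prop) (ae_of_all _ fun a => hM a)
  have j1 := (integrable_expMeasure_one_iff _).1 i1
  have j2 := (integrable_expMeasure_one_iff _).1 i2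
  have hd : ∀ a ∈ Set.Ici (0 : ℝ), HasDerivAt (fun a => Real.exp (-a) * (φ a - φ 0))
      (Real.exp (-a) * φ' a - Real.exp (-a) * (φ a - φ 0)) a := by
    intro a _
    have h1 : HasDerivAt (fun a : ℝ => Real.exp (-a)) (-Real.exp (-a)) a := by
      simpa using (hasDerivAt_id a).neg.exp
    exact (h1.mul ((hφ a).sub_const (φ 0))).congr_deriv (by ring)
  have hlim : Filter.Tendsto (fun a => Real.exp (-a) * (φ a - φ 0)) Filter.atTop (nhds 0) := by
    have h0 : Filter.Tendsto (fun a : ℝ => M * (a ^ 1 * Real.exp (-a))) Filter.atTop (nhds 0) := by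
      simpa using (Real.tendsto_pow_mul_exp_neg_atTop_nhds_zero 1).const_mul M
    refine squeeze_zero_norm' ?_ h0
    filter_upwards [Filter.eventually_ge_atTop 0] with a ha
    rw [norm_mul, Real.norm_of_nonneg (Real.exp_nonneg _), Real.norm_eq_abs]
    have := hlip a
    rw [abs_of_nonneg ha] at this
    nlinarith [mul_le_mul_of_nonneg_left this (Real.exp_nonneg (-a))]
  -- The function `exp (-a) * (φ a - φ 0)` vanishes at `0` and at infinity, so its derivative
  -- integrates to zero.
  have h := integral_Ioi_of_hasDerivAt_of_tendsto' hd (j2.sub j1) hlim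
  rw [integral_sub j2 j1] at h
  rw [integral_expMeasure_one, integral_expMeasure_one]
  simp only [sub_self, mul_zero] at h
  linarith

end Exponential

/-! ### Independence of each draw from the past. -/

section Independence

variable {Ω Z : Type*} [MeasurableSpace Z]

/-- The `σ`-algebra generated by the randomness up to round `t`. -/
@[reducible] def pastSigma (α : ℕ → Ω → ℝ) (r : ℕ → Ω → Z) (t : ℕ) : MeasurableSpace Ω :=
  ⨆ s ≤ t, (MeasurableSpace.comap (α s) inferInstance ⊔ MeasurableSpace.comap (r s) inferInstance)

variable {α : ℕ → Ω → ℝ} {r : ℕ → Ω → Z}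

theorem pastSigma_succ (t : ℕ) :
    pastSigma α r (t + 1) = pastSigma α r t ⊔ MeasurableSpace.comap (α (t + 1)) inferInstance
      ⊔ MeasurableSpace.comap (r (t + 1)) inferInstance := by
  unfold pastSigma
  rw [Nat.iSup_le_succ, sup_assoc]

variable [MeasurableSpace Ω] {P : Measure Ω}

theorem pastSigma_le (hα : ∀ t, Measurable (α t)) (hr : ∀ t, Measurable (r t)) (t : ℕ) :
    pastSigma α r t ≤ ‹MeasurableSpace Ω› :=
  iSup₂_le fun s _ => sup_le (hα s).comap_le (hr s).comap_le

theorem iIndepFun_bool_of_indepFun {A : Bool → Type*} [∀ b, MeasurableSpace (A b)]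
    [IsProbabilityMeasure P] {X : ∀ b, Ω → A b} (h : IndepFun (X false) (X true) P) :
    iIndepFun X P := by
  rw [iIndepFun_iff_measure_inter_preimage_eq_mul]
  intro S sets hs
  rw [indepFun_iff_measure_inter_preimage_eq_mul] at h
  have hS : S = ∅ ∨ S = {false} ∨ S = {true} ∨ S = {false, true} := by
    clear hs; revert S; decide
  rcases hS with rfl | rfl | rfl | rfl
  · simp
  · simp
  · simp
  · rw [Finset.set_biInter_insert, Finset.set_biInter_singleton, Finset.prod_pair (by simp)]
    exact h _ _ (hs false (by simp)) (hs true (by simp))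

theorem comap_inl {A B : Type*} [mA : MeasurableSpace A] [MeasurableSpace B] :
    MeasurableSpace.comap (Sum.inl : A → A ⊕ B) inferInstance = mA :=
  le_antisymm measurable_inl.comap_le fun s hs =>
    ⟨Sum.inl '' s, measurableSet_inl_image.2 hs, Set.preimage_image_eq s Sum.inl_injective⟩

theorem comap_inr {A B : Type*} [MeasurableSpace A] [mB : MeasurableSpace B] :
    MeasurableSpace.comap (Sum.inr : B → A ⊕ B) inferInstance = mB :=
  le_antisymm measurable_inr.comap_le fun s hs =>
    ⟨Sum.inr '' s, measurableSet_inr_image.2 hs, Set.preimage_image_eq s Sum.inr_injective⟩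

/-- Tagging by `Sum.inl` and `Sum.inr` gives both sequences a common codomain without changing the
generated σ-algebras. Independence between the sequences and within each one then combines into
joint independence. -/
theorem iIndep_comap_sum [IsProbabilityMeasure P] (hα : ∀ t, Measurable (α t))
    (hr : ∀ t, Measurable (r t)) (hα_indep : iIndepFun α P) (hr_indep : iIndepFun r P)
    (hαr : IndepFun (fun ω t => α t ω) (fun ω t => r t ω) P) :
    iIndep (fun p : Bool × ℕ => bif p.1 then MeasurableSpace.comap (r p.2) inferInstance
      else MeasurableSpace.comap (α p.2) inferInstance) P := by
  set X : Bool → ℕ → Ω → ℝ ⊕ Z :=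
    fun b t ω => bif b then Sum.inr (r t ω) else Sum.inl (α t ω) with hX
  have hXm : ∀ b t, Measurable (X b t) := by
    rintro (_ | _) t
    · exact measurable_inl.comp (hα t)
    · exact measurable_inr.comp (hr t)
  have h1 : iIndepFun (fun b ω => (X b · ω)) P := by
    refine iIndepFun_bool_of_indepFun ?_
    refine hαr.comp (φ := fun a t => (Sum.inl (a t) : ℝ ⊕ Z))
      (ψ := fun a t => (Sum.inr (a t) : ℝ ⊕ Z)) ?_ ?_
    · exact measurable_pi_lambda _ fun t => measurable_inl.comp (measurable_pi_apply t)
    · exact measurable_pi_lambda _ fun t => measurable_inr.comp (measurable_pi_apply t)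
  have h2 : ∀ b, iIndepFun (X b) P := by
    rintro (_ | _)
    · exact hα_indep.comp (fun _ a => Sum.inl a) fun _ => measurable_inl
    · exact hr_indep.comp (fun _ a => Sum.inr a) fun _ => measurable_inr
  have h3 := (iIndepFun_uncurry' hXm h1 h2).iIndep
  convert h3 using 2 with p
  obtain ⟨_ | _, t⟩ := p
  · change _ = MeasurableSpace.comap (Sum.inl ∘ α t) _
    rw [← MeasurableSpace.comap_comp, comap_inl]
    rfl
  · change _ = MeasurableSpace.comap (Sum.inr ∘ r t) _
    rw [← MeasurableSpace.comap_comp, comap_inr]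
    rfl

/-- The two draws of a round, in order: the step size is independent of the past, and the oracle
sample is independent of the past together with that step size. -/
theorem indep_pastSigma [IsProbabilityMeasure P] (hα : ∀ t, Measurable (α t))
    (hr : ∀ t, Measurable (r t)) (hα_indep : iIndepFun α P) (hr_indep : iIndepFun r P)
    (hαr : IndepFun (fun ω t => α t ω) (fun ω t => r t ω) P) (t : ℕ) :
    Indep (pastSigma α r t) (MeasurableSpace.comap (α (t + 1)) inferInstance) P ∧
    Indep (pastSigma α r t ⊔ MeasurableSpace.comap (α (t + 1)) inferInstance)
      (MeasurableSpace.comap (r (t + 1)) inferInstance) P := by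
  have h := iIndep_comap_sum hα hr hα_indep hr_indep hαr
  have hle : ∀ p : Bool × ℕ, (bif p.1 then MeasurableSpace.comap (r p.2) inferInstance
      else MeasurableSpace.comap (α p.2) inferInstance) ≤ ‹MeasurableSpace Ω› := by
    rintro ⟨_ | _, s⟩
    · exact (hα s).comap_le
    · exact (hr s).comap_le
  have key : ∀ S : Set (Bool × ℕ), (∀ p : Bool × ℕ, p.2 ≤ t → p ∈ S) →
      pastSigma α r t ≤ ⨆ p ∈ S, (bif p.1 then MeasurableSpace.comap (r p.2) inferInstance
      else MeasurableSpace.comap (α p.2) inferInstance) := by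
    intro S hS
    refine iSup₂_le fun s hs => sup_le ?_ ?_
    · exact le_iSup₂_of_le (false, s) (hS _ hs) le_rfl
    · exact le_iSup₂_of_le (true, s) (hS _ hs) le_rfl
  constructor
  · refine indep_of_indep_of_le_left (indep_of_indep_of_le_right
      (indep_iSup_of_disjoint hle h (S := {p | p.2 ≤ t}) (T := {(false, t + 1)}) ?_) ?_) ?_
    · simp
    · exact le_iSup₂_of_le (false, t + 1) rfl le_rfl
    · exact key _ fun p hp => hp
  · refine indep_of_indep_of_le_left (indep_of_indep_of_le_right
      (indep_iSup_of_disjoint hle h (S := {p | p.2 ≤ t ∨ p = (false, t + 1)})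
        (T := {(true, t + 1)}) ?_) ?_) ?_
    · simp
    · exact le_iSup₂_of_le (true, t + 1) rfl le_rfl
    · refine sup_le (key _ fun p hp => Or.inl hp) ?_
      exact le_iSup₂_of_le (false, t + 1) (Or.inr rfl) le_rfl

end Independence

/-! ### Integrating out independent variables. -/

section Fubini

variable {Ω A B : Type*} {m mΩ : MeasurableSpace Ω} [MeasurableSpace A] [MeasurableSpace B]
  {P : Measure Ω} [IsProbabilityMeasure P] {μ : Measure B} {U : Ω → A} {V : Ω → B}

theorem map_prod_eq_of_indep (hm : m ≤ mΩ) (hU : Measurable[m] U)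
    (hV : Measurable V) (hind : Indep m (MeasurableSpace.comap V inferInstance) P)
    (hlaw : P.map V = μ) : P.map (fun ω => (U ω, V ω)) = (P.map U).prod μ := by
  have h : IndepFun U V P := indep_of_indep_of_le_left hind hU.comap_le
  rw [← hlaw]
  exact (indepFun_iff_map_prod_eq_prod_map_map (hU.mono hm le_rfl).aemeasurable
    hV.aemeasurable).1 h

variable [IsProbabilityMeasure μ]

/-- A random variable independent of the past may be integrated out first. -/
theorem integral_eq_integral_integral_of_indep (hm : m ≤ mΩ)
    (hU : Measurable[m] U) (hV : Measurable V)
    (hind : Indep m (MeasurableSpace.comap V inferInstance) P) (hlaw : P.map V = μ)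
    {f : A × B → ℝ} (hf : Measurable f) (hint : Integrable (fun ω => f (U ω, V ω)) P) :
    ∫ ω, f (U ω, V ω) ∂P = ∫ ω, ∫ v, f (U ω, v) ∂μ ∂P := by
  have hU' : Measurable U := hU.mono hm le_rfl
  have hmap := map_prod_eq_of_indep hm hU hV hind hlaw
  have : IsProbabilityMeasure (P.map U) := Measure.isProbabilityMeasure_map hU'.aemeasurable
  have h1 : Integrable f ((P.map U).prod μ) := by
    rw [← hmap, integrable_map_measure hf.aestronglyMeasurable (hU'.prodMk hV).aemeasurable]
    exact hint
  rw [← integral_map (f := f) (hU'.prodMk hV).aemeasurable hf.aestronglyMeasurable, hmap,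
    integral_prod _ h1, integral_map hU'.aemeasurable]
  exact (hf.stronglyMeasurable.integral_prod_right').aestronglyMeasurable

theorem integrable_of_indep (hm : m ≤ mΩ)
    (hU : Measurable[m] U) (hV : Measurable V)
    (hind : Indep m (MeasurableSpace.comap V inferInstance) P) (hlaw : P.map V = μ)
    {f : A × B → ℝ} (hf : Measurable f) (hf0 : ∀ p, 0 ≤ f p) {c : ℝ}
    (h1 : ∀ u, Integrable (fun v => f (u, v)) μ) (h2 : ∀ u, ∫ v, f (u, v) ∂μ ≤ c) :
    Integrable (fun ω => f (U ω, V ω)) P ∧ ∫ ω, f (U ω, V ω) ∂P ≤ c := by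
  have hU' : Measurable U := hU.mono hm le_rfl
  have hmap := map_prod_eq_of_indep hm hU hV hind hlaw
  have : IsProbabilityMeasure (P.map U) := Measure.isProbabilityMeasure_map hU'.aemeasurable
  have h3 : Integrable (fun u => ∫ v, f (u, v) ∂μ) (P.map U) := by
    refine (integrable_const c).mono'
      (hf.stronglyMeasurable.integral_prod_right').aestronglyMeasurable (ae_of_all _ fun u => ?_)
    rw [Real.norm_of_nonneg (integral_nonneg fun v => hf0 _)]
    exact h2 u
  have h4 : Integrable f ((P.map U).prod μ) := by
    refine (integrable_prod_iff hf.aestronglyMeasurable).2 ⟨ae_of_all _ h1, ?_⟩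
    simpa only [Real.norm_of_nonneg (hf0 _)] using h3
  have h5 : Integrable (fun ω => f (U ω, V ω)) P := by
    rw [← hmap, integrable_map_measure hf.aestronglyMeasurable (hU'.prodMk hV).aemeasurable] at h4
    exact h4
  refine ⟨h5, ?_⟩
  rw [integral_eq_integral_integral_of_indep hm hU hV hind hlaw hf h5]
  refine (integral_mono ?_ (integrable_const c) fun ω => h2 (U ω)).trans (by simp)
  exact (integrable_map_measure
    (hf.stronglyMeasurable.integral_prod_right').aestronglyMeasurable hU'.aemeasurable).1 h3

/-- Jensen's inequality for the square, read off from the nonnegativity of the variance. -/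
theorem integral_le_of_integral_sq_le {f : Ω → ℝ} (hfm : AEStronglyMeasurable f P)
    (hf : Integrable (fun ω => f ω ^ 2) P) {K : ℝ} (hK : 0 ≤ K) (h : ∫ ω, f ω ^ 2 ∂P ≤ K ^ 2) :
    Integrable f P ∧ ∫ ω, f ω ∂P ≤ K := by
  have h2 : MemLp f 2 P := (memLp_two_iff_integrable_sq hfm).2 hf
  refine ⟨h2.integrable (by norm_num), ?_⟩
  have h3 := variance_nonneg f P
  rw [variance_eq_sub h2] at h3
  have h4 : (∫ ω, f ω ∂P) ^ 2 ≤ K ^ 2 := by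
    simp only [Pi.pow_apply] at h3
    linarith
  exact (le_abs_self _).trans (abs_le_of_sq_le_sq h4 hK)

end Fubini

/-! ### Random runs and their measurability. -/

section Run

/-- The data of a random run of the conversion with `β`-FTRL. -/
structure Run (Ω Z E : Type*) where
  stoGrad : E → Z → E
  D : ℝ
  β : ℝ
  x₀ : E
  α : ℕ → Ω → ℝ
  r : ℕ → Ω → Z

variable {Ω Z E : Type*} [NormedAddCommGroup E] [InnerProductSpace ℝ E]

namespace Run

/-- The state after round `t`. -/
noncomputable def state (R : Run Ω Z E) (t : ℕ) (ω : Ω) : ConversionState E :=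
  conversion R.stoGrad (scaleFreeFTRL R.D) R.β R.x₀ (fun s => R.α s ω) (fun s => R.r s ω) t

/-- The iterate `x_t`. -/
noncomputable def x (R : Run Ω Z E) (t : ℕ) (ω : Ω) : E :=
  iterate R.stoGrad (scaleFreeFTRL R.D) R.β R.x₀ (fun s => R.α s ω) (fun s => R.r s ω) t

/-- The decision `z_{t+1}`. -/
noncomputable def z (R : Run Ω Z E) (t : ℕ) (ω : Ω) : E :=
  decision R.stoGrad (scaleFreeFTRL R.D) R.β R.x₀ (fun s => R.α s ω) (fun s => R.r s ω) t

/-- The stochastic gradient `g_t`. -/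
noncomputable def g (R : Run Ω Z E) (t : ℕ) (ω : Ω) : E :=
  oracleGrad R.stoGrad (scaleFreeFTRL R.D) R.β R.x₀ (fun s => R.α s ω) (fun s => R.r s ω) t

theorem x_zero (R : Run Ω Z E) (ω : Ω) : R.x 0 ω = R.x₀ := rfl

theorem x_succ (R : Run Ω Z E) (t : ℕ) (ω : Ω) :
    R.x (t + 1) ω = R.x t ω + R.α (t + 1) ω • R.z t ω := rfl

theorem norm_z_le {R : Run Ω Z E} (hD : 0 ≤ R.D) (t : ℕ) (ω : Ω) : ‖R.z t ω‖ ≤ R.D :=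
  norm_scaleFreeFTRL_le hD _

/-- The randomness up to round `t`. -/
@[reducible] def past [MeasurableSpace Z] (R : Run Ω Z E) (t : ℕ) : MeasurableSpace Ω :=
  pastSigma R.α R.r t

/-- The randomness up to round `t` and the step size of round `t + 1`. -/
@[reducible] def mid [MeasurableSpace Z] (R : Run Ω Z E) (t : ℕ) : MeasurableSpace Ω :=
  pastSigma R.α R.r t ⊔ MeasurableSpace.comap (R.α (t + 1)) inferInstance

variable [MeasurableSpace Z]

theorem past_le_mid (R : Run Ω Z E) (t : ℕ) : R.past t ≤ R.mid t := le_sup_left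

theorem mid_le_past_succ (R : Run Ω Z E) (t : ℕ) : R.mid t ≤ R.past (t + 1) := by
  change _ ≤ pastSigma _ _ _
  rw [pastSigma_succ]
  exact le_sup_left

variable [CompleteSpace E] [MeasurableSpace E]

/-- The assumptions on the randomness, the oracle and the parameters of a run. -/
structure IsValid [MeasurableSpace Ω] (R : Run Ω Z E) (P : Measure Ω) (ν : Measure Z) (F : E → ℝ)
    (G sigma : ℝ) : Prop where
  D_pos : 0 < R.D
  β_pos : 0 < R.β
  β_lt_one : R.β < 1
  sigma_nonneg : 0 ≤ sigma
  diff : Differentiable ℝ F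
  grad_le : ∀ x, ‖gradient F x‖ ≤ G
  oracle : IsStoGradOracle F R.stoGrad ν sigma
  measurable_α : ∀ t, Measurable (R.α t)
  measurable_r : ∀ t, Measurable (R.r t)
  α_nonneg : ∀ t ω, 0 ≤ R.α t ω
  map_α : ∀ t, P.map (R.α t) = expMeasure 1
  map_r : ∀ t, P.map (R.r t) = ν
  indep_α : iIndepFun R.α P
  indep_r : iIndepFun R.r P
  indep_αr : IndepFun (fun ω t => R.α t ω) (fun ω t => R.r t ω) P

variable [BorelSpace E] [SecondCountableTopology E]

theorem measurable_scaleFreeFTRL {Ω' : Type*} [MeasurableSpace Ω'] {L : Ω' → List E} (D : ℝ)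
    (h1 : Measurable fun ω => (L ω).sum) (h2 : Measurable fun ω => sumSq (L ω)) :
    Measurable fun ω => scaleFreeFTRL D (L ω) := by
  have h3 : Measurable fun ω => (D / Real.sqrt (sumSq (L ω))) • (L ω).sum :=
    (measurable_const.div h2.sqrt).smul h1
  exact (((measurable_const.div h3.norm).min measurable_const).smul h3).neg

variable [MeasurableSpace Ω] {P : Measure Ω} [IsProbabilityMeasure P] {ν : Measure Z}
  [IsProbabilityMeasure ν] {F : E → ℝ} {G sigma : ℝ} {R : Run Ω Z E}

namespace IsValid

theorem past_le (hR : R.IsValid P ν F G sigma) (t : ℕ) : R.past t ≤ ‹MeasurableSpace Ω› :=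
  pastSigma_le hR.measurable_α hR.measurable_r t

theorem mid_le (hR : R.IsValid P ν F G sigma) (t : ℕ) : R.mid t ≤ ‹MeasurableSpace Ω› :=
  (R.mid_le_past_succ t).trans (hR.past_le _)

/-- The list of losses enters the FTRL decision only through its sum and its sum of squares, so
these two statistics are tracked rather than the list. -/
theorem measurable_state (hR : R.IsValid P ν F G sigma) (t : ℕ) :
    Measurable[R.past t] (R.x t) ∧ Measurable[R.past t] (fun ω => (R.state t ω).losses.sum) ∧
      Measurable[R.past t] (fun ω => sumSq (R.state t ω).losses) := by
  induction t with
  | zero => exact ⟨@measurable_const _ _ _ (R.past 0) _, @measurable_const _ _ _ (R.past 0) _,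
      @measurable_const _ _ _ (R.past 0) _⟩
  | succ t ih =>
    obtain ⟨hx, hs, hq⟩ := ih
    have hle : R.past t ≤ R.past (t + 1) := (R.past_le_mid t).trans (R.mid_le_past_succ t)
    have hα : Measurable[R.past (t + 1)] (R.α (t + 1)) := by
      refine Measurable.mono (comap_measurable (R.α (t + 1))) ?_ le_rfl
      exact le_sup_right.trans (R.mid_le_past_succ t)
    have hr : Measurable[R.past (t + 1)] (R.r (t + 1)) := by
      refine Measurable.mono (comap_measurable (R.r (t + 1))) ?_ le_rfl
      change _ ≤ pastSigma _ _ _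
      rw [pastSigma_succ]
      exact le_sup_right
    have ho := hR.oracle.measurable
    let _ : MeasurableSpace Ω := R.past (t + 1)
    have hx' := hx.mono hle le_rfl
    have hs' := hs.mono hle le_rfl
    have hq' := hq.mono hle le_rfl
    have hz : Measurable (R.z t) := measurable_scaleFreeFTRL R.D hs' hq'
    have hx1 : Measurable (R.x (t + 1)) := hx'.add (hα.smul hz)
    have hg : Measurable (R.g (t + 1)) := ho.comp (hx1.prodMk hr)
    have hv : Measurable fun ω => (R.β ^ (t + 1))⁻¹ • R.g (t + 1) ω := hg.const_smul _
    refine ⟨hx1, ?_, ?_⟩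
    · have h : (fun ω => (R.state (t + 1) ω).losses.sum)
        = fun ω => (R.β ^ (t + 1))⁻¹ • R.g (t + 1) ω + (R.state t ω).losses.sum := rfl
      rw [h]
      exact hv.add hs'
    · have h : (fun ω => sumSq (R.state (t + 1) ω).losses)
        = fun ω => ‖(R.β ^ (t + 1))⁻¹ • R.g (t + 1) ω‖ ^ 2 + sumSq (R.state t ω).losses :=
        funext fun ω => sumSq_cons _ _
      rw [h]
      exact (hv.norm.pow_const 2).add hq'

theorem measurable_x_past (hR : R.IsValid P ν F G sigma) (t : ℕ) : Measurable[R.past t] (R.x t) :=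
  (hR.measurable_state t).1

theorem measurable_z_past (hR : R.IsValid P ν F G sigma) (t : ℕ) : Measurable[R.past t] (R.z t) :=
  @measurable_scaleFreeFTRL _ _ _ _ _ _ _ _ (R.past t) _ R.D (hR.measurable_state t).2.1
    (hR.measurable_state t).2.2

theorem measurable_x_mid (hR : R.IsValid P ν F G sigma) (t : ℕ) :
    Measurable[R.mid t] (R.x (t + 1)) := by
  have hx := (hR.measurable_x_past t).mono (R.past_le_mid t) le_rfl
  have hz := (hR.measurable_z_past t).mono (R.past_le_mid t) le_rfl
  have hα : Measurable[R.mid t] (R.α (t + 1)) :=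
    Measurable.mono (comap_measurable (R.α (t + 1))) le_sup_right le_rfl
  let _ : MeasurableSpace Ω := R.mid t
  exact hx.add (hα.smul hz)

theorem measurable_g_past (hR : R.IsValid P ν F G sigma) (t : ℕ) :
    Measurable[R.past t] (R.g t) := by
  have hx := hR.measurable_x_past t
  have hr : Measurable[R.past t] (R.r t) :=
    Measurable.mono (comap_measurable (R.r t)) (le_iSup₂_of_le t le_rfl le_sup_right) le_rfl
  have ho := hR.oracle.measurable
  let _ : MeasurableSpace Ω := R.past t
  exact ho.comp (hx.prodMk hr)

theorem measurable_x (hR : R.IsValid P ν F G sigma) (t : ℕ) : Measurable (R.x t) :=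
  (hR.measurable_x_past t).mono (hR.past_le t) le_rfl

theorem measurable_z (hR : R.IsValid P ν F G sigma) (t : ℕ) : Measurable (R.z t) :=
  (hR.measurable_z_past t).mono (hR.past_le t) le_rfl

theorem measurable_g (hR : R.IsValid P ν F G sigma) (t : ℕ) : Measurable (R.g t) :=
  (hR.measurable_g_past t).mono (hR.past_le t) le_rfl

theorem G_nonneg (hR : R.IsValid P ν F G sigma) : 0 ≤ G :=
  (norm_nonneg _).trans (hR.grad_le 0)

theorem indep_α_past (hR : R.IsValid P ν F G sigma) (t : ℕ) :
    Indep (R.past t) (MeasurableSpace.comap (R.α (t + 1)) inferInstance) P :=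
  (indep_pastSigma hR.measurable_α hR.measurable_r hR.indep_α hR.indep_r hR.indep_αr t).1

theorem indep_r_mid (hR : R.IsValid P ν F G sigma) (t : ℕ) :
    Indep (R.mid t) (MeasurableSpace.comap (R.r (t + 1)) inferInstance) P :=
  (indep_pastSigma hR.measurable_α hR.measurable_r hR.indep_α hR.indep_r hR.indep_αr t).2

end IsValid

/-- The error of the stochastic gradient `g_t`. -/
noncomputable def noise (R : Run Ω Z E) (F : E → ℝ) (t : ℕ) (ω : Ω) : E :=
  R.g t ω - gradient F (R.x t ω)

end Run

theorem IsStoGradOracle.integral_norm_sq_le {Z E : Type*} [NormedAddCommGroup E]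
    [InnerProductSpace ℝ E] [CompleteSpace E] [MeasurableSpace E] [MeasurableSpace Z] {F : E → ℝ}
    {stoGrad : E → Z → E} {ν : Measure Z} [IsProbabilityMeasure ν] {G sigma : ℝ}
    (h : IsStoGradOracle F stoGrad ν sigma) (hG : ∀ x, ‖gradient F x‖ ≤ G) (x : E) :
    Integrable (fun v => ‖stoGrad x v‖ ^ 2) ν ∧
      ∫ v, ‖stoGrad x v‖ ^ 2 ∂ν ≤ G ^ 2 + sigma ^ 2 := by
  have h1 : ∀ v, ‖stoGrad x v‖ ^ 2 = ‖stoGrad x v - gradient F x‖ ^ 2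
      + (2 * inner ℝ (gradient F x) (stoGrad x v - gradient F x) + ‖gradient F x‖ ^ 2) := by
    intro v
    have := norm_add_sq_real (stoGrad x v - gradient F x) (gradient F x)
    rw [sub_add_cancel, real_inner_comm] at this
    rw [this]; ring
  have h2 : Integrable (fun v => stoGrad x v - gradient F x) ν :=
    (h.integrable x).sub (integrable_const _)
  have h3 : Integrable (fun v => 2 * inner ℝ (gradient F x) (stoGrad x v - gradient F x)) ν :=
    (h2.const_inner _).const_mul 2
  have h4 : Integrable (fun v => 2 * inner ℝ (gradient F x) (stoGrad x v - gradient F x)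
      + ‖gradient F x‖ ^ 2) ν := h3.add (integrable_const _)
  have h5 : ∫ v, inner ℝ (gradient F x) (stoGrad x v - gradient F x) ∂ν = 0 := by
    rw [integral_inner h2, integral_sub (h.integrable x) (integrable_const _), h.unbiased]
    simp
  rw [show (fun v => ‖stoGrad x v‖ ^ 2) = _ from funext h1]
  refine ⟨(h.integrable_sq x).add h4, ?_⟩
  rw [integral_add (h.integrable_sq x) h4, integral_add h3 (integrable_const _),
    integral_const_mul, h5]
  have := pow_le_pow_left₀ (norm_nonneg _) (hG x) 2
  have := h.variance_le x
  simp
  linarith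

end Run

/-! ### Expected increments, noise and gradient norms. -/

section RunExpectation

variable {Ω Z E : Type*} [NormedAddCommGroup E] [InnerProductSpace ℝ E] [CompleteSpace E]
  [MeasurableSpace E] [BorelSpace E] [SecondCountableTopology E]
  [MeasurableSpace Ω] [MeasurableSpace Z] {P : Measure Ω} [IsProbabilityMeasure P] {ν : Measure Z}
  [IsProbabilityMeasure ν] {F : E → ℝ} {G sigma : ℝ} {R : Run Ω Z E}

namespace Run.IsValid

theorem sq_norm_g (hR : R.IsValid P ν F G sigma) (t : ℕ) :
    Integrable (fun ω => ‖R.g (t + 1) ω‖ ^ 2) P ∧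
      ∫ ω, ‖R.g (t + 1) ω‖ ^ 2 ∂P ≤ G ^ 2 + sigma ^ 2 :=
  integrable_of_indep (f := fun p : E × Z => ‖R.stoGrad p.1 p.2‖ ^ 2) (hR.mid_le t)
    (hR.measurable_x_mid t) (hR.measurable_r (t + 1)) (hR.indep_r_mid t) (hR.map_r _)
    (hR.oracle.measurable.norm.pow_const 2) (fun _ => by positivity)
    (fun x => (hR.oracle.integral_norm_sq_le hR.grad_le x).1)
    (fun x => (hR.oracle.integral_norm_sq_le hR.grad_le x).2)

theorem sq_norm_noise (hR : R.IsValid P ν F G sigma) (t : ℕ) :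
    Integrable (fun ω => ‖R.noise F (t + 1) ω‖ ^ 2) P ∧
      ∫ ω, ‖R.noise F (t + 1) ω‖ ^ 2 ∂P ≤ sigma ^ 2 :=
  integrable_of_indep (f := fun p : E × Z => ‖R.stoGrad p.1 p.2 - gradient F p.1‖ ^ 2) (hR.mid_le t)
    (hR.measurable_x_mid t) (hR.measurable_r (t + 1)) (hR.indep_r_mid t) (hR.map_r _)
    ((hR.oracle.measurable.sub ((measurable_gradient F).comp measurable_fst)).norm.pow_const 2)
    (fun _ => by positivity) hR.oracle.integrable_sq hR.oracle.variance_le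

theorem measurable_noise_past (hR : R.IsValid P ν F G sigma) (t : ℕ) :
    Measurable[R.past t] (R.noise F t) :=
  (hR.measurable_g_past t).sub ((measurable_gradient F).comp (hR.measurable_x_past t))

theorem measurable_noise (hR : R.IsValid P ν F G sigma) (t : ℕ) : Measurable (R.noise F t) :=
  (hR.measurable_noise_past t).mono (hR.past_le t) le_rfl

theorem memLp_noise (hR : R.IsValid P ν F G sigma) (t : ℕ) : MemLp (R.noise F (t + 1)) 2 P :=
  (memLp_two_iff_integrable_sq_norm (hR.measurable_noise _).aestronglyMeasurable).2
    (hR.sq_norm_noise t).1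

/-- The noise is uncorrelated with the past. -/
theorem integral_inner_noise (hR : R.IsValid P ν F G sigma) (t : ℕ) {W : Ω → E}
    (hW : Measurable[R.past t] W) (hW2 : MemLp W 2 P) :
    Integrable (fun ω => inner ℝ (W ω) (R.noise F (t + 1) ω)) P ∧
      ∫ ω, inner ℝ (W ω) (R.noise F (t + 1) ω) ∂P = 0 := by
  have hint : Integrable (fun ω => inner ℝ (W ω) (R.noise F (t + 1) ω)) P := by
    have h1 : Integrable (fun ω => ‖W ω‖ ^ 2 + ‖R.noise F (t + 1) ω‖ ^ 2) P :=
      hW2.integrable_norm_pow (p := 2) (by norm_num) |>.add (hR.sq_norm_noise t).1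
    refine h1.mono' (Measurable.inner (hW.mono (hR.past_le t) le_rfl)
      (hR.measurable_noise _)).aestronglyMeasurable (ae_of_all _ fun ω => ?_)
    refine (norm_inner_le_norm _ _).trans ?_
    nlinarith [sq_nonneg (‖W ω‖ - ‖R.noise F (t + 1) ω‖), sq_nonneg ‖W ω‖,
      sq_nonneg ‖R.noise F (t + 1) ω‖]
  refine ⟨hint, ?_⟩
  have hf : Measurable fun p : (E × E) × Z =>
      (inner ℝ p.1.1 (R.stoGrad p.1.2 p.2 - gradient F p.1.2) : ℝ) := by
    have h1 : Measurable fun p : (E × E) × Z => R.stoGrad p.1.2 p.2 :=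
      hR.oracle.measurable.comp ((measurable_snd.comp measurable_fst).prodMk measurable_snd)
    have h2 : Measurable fun p : (E × E) × Z => gradient F p.1.2 :=
      (measurable_gradient F).comp (measurable_snd.comp measurable_fst)
    exact (measurable_fst.comp measurable_fst).inner (h1.sub h2)
  -- The oracle sample is integrated out last in time: `x_{t+1}` already depends on the new step
  -- size, so the conditioning is on `mid` and not on `past`.
  have h := integral_eq_integral_integral_of_indep (hR.mid_le t)
    (U := fun ω => (W ω, R.x (t + 1) ω))
    ((hW.mono (R.past_le_mid t) le_rfl).prodMk (hR.measurable_x_mid t))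
    (hR.measurable_r (t + 1)) (hR.indep_r_mid t) (hR.map_r _) hf hint
  refine h.trans ?_
  have h0 : ∀ ω, ∫ v, (inner ℝ (W ω) (R.stoGrad (R.x (t + 1) ω) v
      - gradient F (R.x (t + 1) ω)) : ℝ) ∂ν = 0 := by
    intro ω
    have hi : Integrable (fun v => R.stoGrad (R.x (t + 1) ω) v - gradient F (R.x (t + 1) ω)) ν :=
      (hR.oracle.integrable _).sub (integrable_const _)
    rw [integral_inner hi, integral_sub (hR.oracle.integrable _) (integrable_const _), hR.oracle.unbiased]
    simp
  simp [h0]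

theorem memLp_z (hR : R.IsValid P ν F G sigma) (t : ℕ) : MemLp (R.z t) 2 P :=
  MemLp.of_bound (hR.measurable_z t).aestronglyMeasurable R.D
    (ae_of_all _ fun ω => norm_z_le hR.D_pos.le t ω)

/-- Given the past, `x_{t+1} = x_t + a z` with `a` exponential and `x_t`, `z` fixed, so the
one-dimensional identity applies to `a ↦ F (x_t + a z)`. -/
theorem integral_increment (hR : R.IsValid P ν F G sigma) (t : ℕ) :
    Integrable (fun ω => F (R.x (t + 1) ω) - F (R.x t ω)) P ∧
    Integrable (fun ω => inner ℝ (gradient F (R.x (t + 1) ω)) (R.z t ω)) P ∧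
    ∫ ω, inner ℝ (gradient F (R.x (t + 1) ω)) (R.z t ω) ∂P
      = ∫ ω, (F (R.x (t + 1) ω) - F (R.x t ω)) ∂P := by
  have : IsProbabilityMeasure (expMeasure 1) := isProbabilityMeasure_expMeasure one_pos
  have hGD : 0 ≤ G * R.D := mul_nonneg hR.G_nonneg hR.D_pos.le
  have hFm : Measurable F := hR.diff.continuous.measurable
  have i1 : Integrable (fun ω => inner ℝ (gradient F (R.x (t + 1) ω)) (R.z t ω)) P := by
    refine (integrable_const (G * R.D)).mono' (((measurable_gradient F).comp
      (hR.measurable_x _)).inner (hR.measurable_z t)).aestronglyMeasurable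
      (ae_of_all _ fun ω => ?_)
    exact (norm_inner_le_norm _ _).trans
      (mul_le_mul (hR.grad_le _) (norm_z_le hR.D_pos.le t ω) (norm_nonneg _) hR.G_nonneg)
  have iα : Integrable (R.α (t + 1)) P := by
    have h := integrable_id_expMeasure_one
    rw [← hR.map_α (t + 1)] at h
    exact h.comp_measurable (hR.measurable_α _)
  have i2 : Integrable (fun ω => F (R.x (t + 1) ω) - F (R.x t ω)) P := by
    refine (iα.norm.const_mul (G * R.D)).mono' ((hFm.comp (hR.measurable_x _)).sub
      (hFm.comp (hR.measurable_x _))).aestronglyMeasurable (ae_of_all _ fun ω => ?_)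
    refine (abs_sub_le_of_norm_gradient_le hR.diff hR.grad_le _ _).trans ?_
    rw [R.x_succ, add_sub_cancel_left, norm_smul, mul_assoc, mul_comm R.D]
    have := norm_z_le hR.D_pos.le t ω
    have := hR.G_nonneg
    gcongr
  refine ⟨i2, i1, ?_⟩
  have hl : Measurable fun p : (E × E) × ℝ => p.1.1 + p.2 • p.1.2 :=
    (measurable_fst.comp measurable_fst).add
      (measurable_snd.smul (measurable_snd.comp measurable_fst))
  have hU := (hR.measurable_x_past t).prodMk (hR.measurable_z_past t)
  have e1 := integral_eq_integral_integral_of_indep (hR.past_le t)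
    (f := fun p : (E × E) × ℝ => (inner ℝ (gradient F (p.1.1 + p.2 • p.1.2)) p.1.2 : ℝ)) hU
    (hR.measurable_α (t + 1)) (hR.indep_α_past t) (hR.map_α _)
    (((measurable_gradient F).comp hl).inner (measurable_snd.comp measurable_fst)) i1
  have e2 := integral_eq_integral_integral_of_indep (hR.past_le t)
    (f := fun p : (E × E) × ℝ => F (p.1.1 + p.2 • p.1.2) - F p.1.1) hU
    (hR.measurable_α (t + 1)) (hR.indep_α_past t) (hR.map_α _)
    ((hFm.comp hl).sub (hFm.comp (measurable_fst.comp measurable_fst))) i2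
  refine e1.trans (Eq.trans ?_ e2.symm)
  congr 1
  ext ω
  have h := integral_sub_eq_integral_deriv_expMeasure_one (M := G * ‖R.z t ω‖)
    (hasDerivAt_comp_line hR.diff (R.x t ω) (R.z t ω))
    (fun a => (abs_real_inner_le_norm _ _).trans
      (mul_le_mul_of_nonneg_right (hR.grad_le _) (norm_nonneg _)))
    (fun a => by
      refine (abs_sub_le_of_norm_gradient_le hR.diff hR.grad_le _ _).trans (le_of_eq ?_)
      rw [zero_smul, add_zero, add_sub_cancel_left, norm_smul, Real.norm_eq_abs]; ring)
  simp only [zero_smul, add_zero] at h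
  exact h.symm

theorem integral_inner_g_z (hR : R.IsValid P ν F G sigma) (t : ℕ) :
    Integrable (fun ω => inner ℝ (R.g (t + 1) ω) (R.z t ω)) P ∧
    ∫ ω, inner ℝ (R.g (t + 1) ω) (R.z t ω) ∂P = ∫ ω, (F (R.x (t + 1) ω) - F (R.x t ω)) ∂P := by
  obtain ⟨i1, v1⟩ := hR.integral_inner_noise t (hR.measurable_z_past t) (hR.memLp_z t)
  obtain ⟨-, i2, v2⟩ := hR.integral_increment t
  have h : ∀ ω, inner ℝ (R.g (t + 1) ω) (R.z t ω) = inner ℝ (R.z t ω) (R.noise F (t + 1) ω)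
      + inner ℝ (gradient F (R.x (t + 1) ω)) (R.z t ω) := by
    intro ω
    rw [Run.noise, inner_sub_right, real_inner_comm, real_inner_comm (R.z t ω) (gradient F _)]
    ring
  rw [show (fun ω => inner ℝ (R.g (t + 1) ω) (R.z t ω)) = _ from funext h]
  exact ⟨i1.add i2, by rw [integral_add i1 i2, v1, v2, zero_add]⟩

/-- The noises are martingale differences, so cross terms vanish and variances add with weights `β ^
2`. Measurability and square integrability are carried through the induction because the next cross
term needs them. -/
theorem discountedSum_noise (hR : R.IsValid P ν F G sigma) (t : ℕ) :
    Measurable[R.past t] (fun ω => discountedSum R.β (R.noise F · ω) t) ∧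
    MemLp (fun ω => discountedSum R.β (R.noise F · ω) t) 2 P ∧
    ∫ ω, ‖discountedSum R.β (R.noise F · ω) t‖ ^ 2 ∂P
      ≤ discountedSum (R.β ^ 2) (fun _ => sigma ^ 2) t := by
  induction t with
  | zero => exact ⟨by simp, by simp, by simp⟩
  | succ t ih =>
    obtain ⟨hm, hL, hv⟩ := ih
    have h0 : (fun ω => discountedSum R.β (R.noise F · ω) (t + 1))
        = fun ω => R.β • discountedSum R.β (R.noise F · ω) t + R.noise F (t + 1) ω :=
      funext fun ω => discountedSum_succ _ _ _
    set N := fun ω => discountedSum R.β (R.noise F · ω) t with hN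
    have hm' : Measurable[R.past t] fun ω => R.β • N ω := hm.const_smul R.β
    have hle : R.past t ≤ R.past (t + 1) := (R.past_le_mid t).trans (R.mid_le_past_succ t)
    have hL' : MemLp (fun ω => R.β • N ω) 2 P := hL.const_smul R.β
    obtain ⟨i1, v1⟩ := hR.integral_inner_noise t hm' hL'
    obtain ⟨i2, v2⟩ := hR.sq_norm_noise t
    have i3 : Integrable (fun ω => ‖N ω‖ ^ 2) P := hL.integrable_norm_pow (p := 2) (by norm_num)
    refine ⟨?_, ?_, ?_⟩
    · rw [h0]
      exact (hm'.mono hle le_rfl).add (hR.measurable_noise_past (t + 1))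
    · rw [h0]
      exact hL'.add (hR.memLp_noise t)
    · have h1 : ∀ ω, ‖discountedSum R.β (R.noise F · ω) (t + 1)‖ ^ 2
          = R.β ^ 2 * ‖N ω‖ ^ 2 + (2 * inner ℝ (R.β • N ω) (R.noise F (t + 1) ω)
            + ‖R.noise F (t + 1) ω‖ ^ 2) := by
        intro ω
        rw [discountedSum_succ, norm_add_sq_real, norm_smul, mul_pow, Real.norm_eq_abs, sq_abs]
        ring
      simp_rw [h1]
      have i4 : Integrable (fun ω => 2 * inner ℝ (R.β • N ω) (R.noise F (t + 1) ω)
            + ‖R.noise F (t + 1) ω‖ ^ 2) P := (i1.const_mul 2).add i2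
      rw [integral_add (i3.const_mul _) i4, integral_add (i1.const_mul 2) i2, integral_const_mul,
        integral_const_mul, v1, discountedSum_succ, smul_eq_mul]
      have := mul_le_mul_of_nonneg_left hv (sq_nonneg R.β)
      simp only [hN] at *
      linarith

theorem discountedSum_const_sq_le (hR : R.IsValid P ν F G sigma) {c : ℝ} (hc : 0 ≤ c) (t : ℕ) :
    discountedSum (R.β ^ 2) (fun _ => c) t ≤ c / (1 - R.β) := by
  have h0 := hR.β_pos
  have h1 := hR.β_lt_one
  have h2 : R.β ^ 2 < 1 := by nlinarith
  rw [discountedSum_const h2.ne, div_mul_eq_mul_div]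
  have h3 : 0 ≤ (R.β ^ 2) ^ t := by positivity
  refine div_le_div₀ hc ?_ (by linarith) (by nlinarith)
  nlinarith

theorem integral_norm_discountedSum_noise (hR : R.IsValid P ν F G sigma) {q : ℝ} (hq : 0 < q)
    (hqβ : q ^ 2 = 1 - R.β) (t : ℕ) :
    Integrable (fun ω => ‖discountedSum R.β (R.noise F · ω) t‖) P ∧
    ∫ ω, ‖discountedSum R.β (R.noise F · ω) t‖ ∂P ≤ (G + sigma) / q := by
  obtain ⟨-, hL, hv⟩ := hR.discountedSum_noise t
  have hG := hR.G_nonneg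
  have hs := hR.sigma_nonneg
  refine integral_le_of_integral_sq_le hL.1.norm (hL.integrable_norm_pow (p := 2) (by norm_num))
    (by positivity) ?_
  refine hv.trans ((hR.discountedSum_const_sq_le (sq_nonneg _) t).trans ?_)
  -- The bound `σ ≤ G + σ` is wasteful, but it gives the noise and regret terms a common form.
  rw [← hqβ, div_pow]
  gcongr
  linarith

theorem integral_sqrt_discountedSum_g (hR : R.IsValid P ν F G sigma) {q : ℝ} (hq : 0 < q)
    (hqβ : q ^ 2 = 1 - R.β) (t : ℕ) :
    Integrable (fun ω => Real.sqrt (discountedSum (R.β ^ 2) (fun s => ‖R.g s ω‖ ^ 2) t)) P ∧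
    ∫ ω, Real.sqrt (discountedSum (R.β ^ 2) (fun s => ‖R.g s ω‖ ^ 2) t) ∂P ≤ (G + sigma) / q := by
  have hG := hR.G_nonneg
  have hs := hR.sigma_nonneg
  have hsq : ∀ ω, Real.sqrt (discountedSum (R.β ^ 2) (fun s => ‖R.g s ω‖ ^ 2) t) ^ 2
      = discountedSum (R.β ^ 2) (fun s => ‖R.g s ω‖ ^ 2) t := fun ω =>
    Real.sq_sqrt (Finset.sum_nonneg fun s _ => smul_nonneg (by positivity) (by positivity))
  have hint : ∀ s ∈ Finset.Icc 1 t,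
      Integrable (fun ω => (R.β ^ 2) ^ (t - s) • ‖R.g s ω‖ ^ 2) P := by
    intro s hs
    obtain ⟨s, rfl⟩ := Nat.exists_eq_add_of_le' (Finset.mem_Icc.1 hs).1
    exact (hR.sq_norm_g s).1.const_mul _
  have hm : Measurable fun ω => discountedSum (R.β ^ 2) (fun s => ‖R.g s ω‖ ^ 2) t :=
    Finset.measurable_sum _ fun s _ => ((hR.measurable_g s).norm.pow_const 2).const_mul _
  refine integral_le_of_integral_sq_le hm.sqrt.aestronglyMeasurable ?_ (by positivity) ?_
  · simp_rw [hsq]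
    exact integrable_finsetSum _ hint
  · simp_rw [hsq]
    have h1 : ∫ ω, discountedSum (R.β ^ 2) (fun s => ‖R.g s ω‖ ^ 2) t ∂P
        ≤ discountedSum (R.β ^ 2) (fun _ => G ^ 2 + sigma ^ 2) t := by
      unfold discountedSum
      rw [integral_finsetSum _ hint]
      refine Finset.sum_le_sum fun s hs => ?_
      obtain ⟨s, rfl⟩ := Nat.exists_eq_add_of_le' (Finset.mem_Icc.1 hs).1
      rw [integral_smul]
      exact smul_le_smul_of_nonneg_left (hR.sq_norm_g s).2 (by positivity)
    refine h1.trans ((hR.discountedSum_const_sq_le (by positivity) t).trans ?_)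
    rw [← hqβ, div_pow]
    gcongr
    nlinarith

end Run.IsValid

end RunExpectation

/-! ### Variance of the iterates and the averaged bound. -/

section RunBounds

variable {Ω Z E : Type*} [NormedAddCommGroup E] [InnerProductSpace ℝ E] [CompleteSpace E]
  [MeasurableSpace E] [BorelSpace E] [SecondCountableTopology E]
  [MeasurableSpace Ω] [MeasurableSpace Z] {P : Measure Ω} [IsProbabilityMeasure P] {ν : Measure Z}
  [IsProbabilityMeasure ν] {F : E → ℝ} {G sigma : ℝ} {R : Run Ω Z E}

namespace Run.IsValid

theorem memLp_α (hR : R.IsValid P ν F G sigma) (t : ℕ) : MemLp (R.α t) 2 P := by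
  refine (memLp_two_iff_integrable_sq (hR.measurable_α t).aestronglyMeasurable).2 ?_
  have h := integrable_sq_expMeasure_one
  rw [← hR.map_α t] at h
  exact h.comp_measurable (hR.measurable_α t)

theorem integral_α (hR : R.IsValid P ν F G sigma) (t : ℕ) : ∫ ω, R.α t ω ∂P = 1 := by
  rw [← integral_id_expMeasure_one, ← hR.map_α t,
    integral_map (hR.measurable_α t).aemeasurable measurable_id'.aestronglyMeasurable]

theorem variance_α (hR : R.IsValid P ν F G sigma) (t : ℕ) : variance (R.α t) P = 1 := by
  have h : ∫ ω, R.α t ω ^ 2 ∂P = 2 := by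
    rw [← integral_sq_expMeasure_one, ← hR.map_α t,
      integral_map (hR.measurable_α t).aemeasurable
        (measurable_id'.pow_const 2).aestronglyMeasurable]
  rw [variance_eq_sub (hR.memLp_α t), hR.integral_α t]
  simp only [Pi.pow_apply, h]
  norm_num

/-- The sum of `k` independent variables of mean `1` and variance `1` has mean `k` and variance `k`.
-/
theorem sq_sum_α (hR : R.IsValid P ν F G sigma) (I : Finset ℕ) :
    Integrable (fun ω => (∑ i ∈ I, R.α i ω) ^ 2) P ∧
    ∫ ω, (∑ i ∈ I, R.α i ω) ^ 2 ∂P = (I.card : ℝ) ^ 2 + I.card := by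
  have h1 : MemLp (∑ i ∈ I, R.α i) 2 P := memLp_finsetSum' I fun i _ => hR.memLp_α i
  have h2 := IndepFun.variance_sum (s := I) (fun i _ => hR.memLp_α i)
    fun i _ j _ hij => hR.indep_α.indepFun hij
  rw [variance_eq_sub h1] at h2
  simp only [hR.variance_α, Finset.sum_apply, Pi.pow_apply, Finset.sum_const, nsmul_eq_mul,
    mul_one] at h2
  rw [integral_finsetSum _ fun i _ => (hR.memLp_α i).integrable (by norm_num)] at h2
  simp only [hR.integral_α, Finset.sum_const, nsmul_eq_mul, mul_one] at h2
  refine ⟨?_, by linarith⟩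
  simpa using (memLp_two_iff_integrable_sq h1.1).1 h1

theorem norm_x_sub_le (hR : R.IsValid P ν F G sigma) {s n : ℕ} (h : s ≤ n) (ω : Ω) :
    ‖R.x n ω - R.x s ω‖ ≤ R.D * ∑ i ∈ Finset.Ioc s n, R.α i ω := by
  induction n, h using Nat.le_induction with
  | base => simp
  | succ n hn ih =>
    rw [Finset.sum_Ioc_succ_top (by omega), R.x_succ, add_sub_right_comm, mul_add]
    refine (norm_add_le _ _).trans (add_le_add ih ?_)
    rw [norm_smul, Real.norm_of_nonneg (hR.α_nonneg _ _), mul_comm]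
    exact mul_le_mul_of_nonneg_right (norm_z_le hR.D_pos.le n ω) (hR.α_nonneg _ _)

theorem sq_norm_x_sub (hR : R.IsValid P ν F G sigma) {s n : ℕ} (h : s ≤ n) :
    Integrable (fun ω => ‖R.x n ω - R.x s ω‖ ^ 2) P ∧
    ∫ ω, ‖R.x n ω - R.x s ω‖ ^ 2 ∂P ≤ R.D ^ 2 * (((n : ℝ) - s) ^ 2 + ((n : ℝ) - s)) := by
  obtain ⟨i1, v1⟩ := hR.sq_sum_α (Finset.Ioc s n)
  have h1 : ∀ ω, ‖R.x n ω - R.x s ω‖ ^ 2 ≤ R.D ^ 2 * (∑ i ∈ Finset.Ioc s n, R.α i ω) ^ 2 := by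
    intro ω
    rw [← mul_pow]
    exact pow_le_pow_left₀ (norm_nonneg _) (hR.norm_x_sub_le h ω) 2
  have i2 : Integrable (fun ω => ‖R.x n ω - R.x s ω‖ ^ 2) P := by
    refine (i1.const_mul (R.D ^ 2)).mono' (((hR.measurable_x n).sub
      (hR.measurable_x s)).norm.pow_const 2).aestronglyMeasurable (ae_of_all _ fun ω => ?_)
    rw [Real.norm_of_nonneg (by positivity)]
    exact h1 ω
  refine ⟨i2, (integral_mono i2 (i1.const_mul _) h1).trans (le_of_eq ?_)⟩
  rw [integral_const_mul, v1, Nat.card_Ioc, Nat.cast_sub h]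

/-- With `V = D² / (1 - β)²`, the mean squared distance to the new iterate is at most `2 V`, so the
recursion gives `(1 - γ)² V + 2 γ (1 - γ) V = (1 - γ²) V ≤ V`: the bound `V` reproduces itself. -/
theorem integral_discountedVariance (hR : R.IsValid P ν F G sigma) {t : ℕ} (ht : 1 ≤ t) :
    Integrable (fun ω => discountedVariance R.β (R.x · ω) t) P ∧
    ∫ ω, discountedVariance R.β (R.x · ω) t ∂P ≤ R.D ^ 2 / (1 - R.β) ^ 2 := by
  have hβ0 := hR.β_pos.le
  have hβ1 := hR.β_lt_one
  have hp : 0 < 1 - R.β := by linarith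
  induction t, ht using Nat.le_induction with
  | base =>
    simp only [discountedVariance_one hβ1]
    exact ⟨integrable_zero _ _ _, by simpa using by positivity⟩
  | succ t ht ih =>
    obtain ⟨i1, v1⟩ := ih
    have h1 := one_sub_pow_pos hβ0 hβ1 ht
    have h2 := one_sub_pow_pos hβ0 hβ1 (t := t + 1) (by omega)
    have i2 : ∀ s ∈ Finset.Icc 1 t,
        Integrable (fun ω => R.β ^ (t - s) • ‖R.x (t + 1) ω - R.x s ω‖ ^ 2) P := fun s hs =>
      (hR.sq_norm_x_sub ((Finset.mem_Icc.1 hs).2.trans t.le_succ)).1.const_mul _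
    have i3 : Integrable
        (fun ω => discountedSum R.β (fun s => ‖R.x (t + 1) ω - R.x s ω‖ ^ 2) t) P :=
      integrable_finsetSum _ i2
    have v3 : ∫ ω, discountedSum R.β (fun s => ‖R.x (t + 1) ω - R.x s ω‖ ^ 2) t ∂P
        ≤ R.D ^ 2 * (2 * (1 - R.β ^ t) / (1 - R.β) ^ 3) := by
      refine le_trans ?_ (mul_le_mul_of_nonneg_left (discountedSum_age_sq_le hβ0 hβ1 t)
        (sq_nonneg _))
      unfold discountedSum
      rw [integral_finsetSum _ i2, Finset.mul_sum]
      refine Finset.sum_le_sum fun s hs => ?_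
      have h3 := (hR.sq_norm_x_sub ((Finset.mem_Icc.1 hs).2.trans t.le_succ)).2
      simp only [smul_eq_mul]
      rw [integral_const_mul, mul_left_comm]
      refine mul_le_mul_of_nonneg_left (h3.trans (le_of_eq ?_)) (by positivity)
      push_cast
      ring
    simp_rw [discountedVariance_succ hβ0 hβ1 _ ht]
    have i4 := (i3.const_mul ((1 - R.β) / (1 - R.β ^ t))).const_mul
      ((1 - R.β) / (1 - R.β ^ (t + 1)) * ((R.β - R.β ^ (t + 1)) / (1 - R.β ^ (t + 1))))
    refine ⟨(i1.const_mul _).add i4, ?_⟩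
    rw [integral_add (i1.const_mul _) i4, integral_const_mul, integral_const_mul,
      integral_const_mul]
    set γ := (1 - R.β) / (1 - R.β ^ (t + 1)) with hγ
    have hγ' : (R.β - R.β ^ (t + 1)) / (1 - R.β ^ (t + 1)) = 1 - γ := by
      rw [hγ]; field_simp; ring
    have hγ0 : 0 ≤ γ := by positivity
    have hγ1 : 0 ≤ 1 - γ := by
      rw [← hγ']
      refine div_nonneg ?_ h2.le
      have := pow_le_one₀ hβ0 hβ1.le (n := t)
      rw [pow_succ]; nlinarith
    rw [hγ']
    set V := R.D ^ 2 / (1 - R.β) ^ 2 with hV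
    have hV0 : 0 ≤ V := by positivity
    have v4 : (1 - R.β) / (1 - R.β ^ t)
        * ∫ ω, discountedSum R.β (fun s => ‖R.x (t + 1) ω - R.x s ω‖ ^ 2) t ∂P ≤ 2 * V := by
      refine (mul_le_mul_of_nonneg_left v3 (by positivity)).trans (le_of_eq ?_)
      rw [hV]; field_simp
    have e1 := mul_le_mul_of_nonneg_left v1 (sq_nonneg (1 - γ))
    have e2 := mul_le_mul_of_nonneg_left v4 (mul_nonneg hγ0 hγ1)
    nlinarith [mul_nonneg (sq_nonneg γ) hV0]

/-- A discounted average of gradients is no longer than the longest gradient. -/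
theorem norm_discountedMean_gradient_le (hR : R.IsValid P ν F G sigma) {t : ℕ} (ht : 1 ≤ t)
    (ω : Ω) : ‖discountedMean R.β (fun s => gradient F (R.x s ω)) t‖ ≤ G := by
  have hβ0 := hR.β_pos.le
  have hβ1 := hR.β_lt_one
  have h1 := one_sub_pow_pos hβ0 hβ1 ht
  have hp : 0 < 1 - R.β := by linarith
  rw [discountedMean_eq_sum]
  calc _ ≤ ∑ s ∈ Finset.Icc 1 t, (1 - R.β) / (1 - R.β ^ t) * R.β ^ (t - s) * G := by
        refine norm_sum_le_of_le _ fun s _ => ?_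
        have h2 : 0 ≤ (1 - R.β) / (1 - R.β ^ t) * R.β ^ (t - s) := by positivity
        rw [norm_smul, Real.norm_of_nonneg h2]
        exact mul_le_mul_of_nonneg_left (hR.grad_le _) h2
    _ = G := by rw [← Finset.sum_mul, discountedWeights_sum hβ0 hβ1 ht, one_mul]

theorem measurable_discountedSum_gradient (hR : R.IsValid P ν F G sigma) (t : ℕ) :
    Measurable fun ω => discountedSum R.β (fun s => gradient F (R.x s ω)) t :=
  Finset.measurable_sum _ fun s _ => ((measurable_gradient F).comp (hR.measurable_x s)).const_smul _

theorem integrable_norm_discountedMean (hR : R.IsValid P ν F G sigma) {t : ℕ} (ht : 1 ≤ t) :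
    Integrable (fun ω => ‖discountedMean R.β (fun s => gradient F (R.x s ω)) t‖) P := by
  refine (integrable_const G).mono'
    ((hR.measurable_discountedSum_gradient t).const_smul _).norm.aestronglyMeasurable
    (ae_of_all _ fun ω => ?_)
  rw [norm_norm]
  exact hR.norm_discountedMean_gradient_le ht ω

theorem discountedSum_eq_smul_mean (hR : R.IsValid P ν F G sigma) {t : ℕ} (ht : 1 ≤ t)
    (y : ℕ → E) :
    ‖discountedSum R.β y t‖ = (1 - R.β ^ t) / (1 - R.β) * ‖discountedMean R.β y t‖ := by
  have h1 := one_sub_pow_pos hR.β_pos.le hR.β_lt_one ht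
  have hp : 0 < 1 - R.β := by linarith [hR.β_lt_one]
  rw [discountedMean, norm_smul, Real.norm_of_nonneg (by positivity)]
  field_simp

/-- The expected discounted loss after round `t`. -/
theorem discountedSum_loss_le (hR : R.IsValid P ν F G sigma) {q : ℝ} (hq : 0 < q)
    (hqβ : q ^ 2 = 1 - R.β) {t : ℕ} (ht : 1 ≤ t) :
    discountedSum R.β (fun s => ∫ ω, inner ℝ (R.g s ω) (R.z (s - 1) ω) ∂P) t
      ≤ -R.D * ((1 - R.β ^ t) / (1 - R.β)
          * ∫ ω, ‖discountedMean R.β (fun s => gradient F (R.x s ω)) t‖ ∂P)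
        + 7 / 2 * R.D * ((G + sigma) / q) := by
  have hD := hR.D_pos
  have i0 : ∀ s ∈ Finset.Icc 1 t,
      Integrable (fun ω => R.β ^ (t - s) • (inner ℝ (R.g s ω) (R.z (s - 1) ω) : ℝ)) P := by
    intro s hs
    obtain ⟨s, rfl⟩ := Nat.exists_eq_add_of_le' (Finset.mem_Icc.1 hs).1
    exact (hR.integral_inner_g_z s).1.const_mul _
  have h1 : discountedSum R.β (fun s => ∫ ω, inner ℝ (R.g s ω) (R.z (s - 1) ω) ∂P) t
      = ∫ ω, discountedSum R.β (fun s => inner ℝ (R.g s ω) (R.z (s - 1) ω)) t ∂P := by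
    unfold discountedSum
    rw [integral_finsetSum _ i0]
    simp only [integral_smul]
  obtain ⟨i1, v1⟩ := hR.integral_norm_discountedSum_noise hq hqβ t
  obtain ⟨i2, v2⟩ := hR.integral_sqrt_discountedSum_g hq hqβ t
  have i3 := hR.integrable_norm_discountedMean ht
  have i4 := (i3.const_mul ((1 - R.β ^ t) / (1 - R.β))).const_mul (-R.D)
  have i5 : Integrable (fun ω => -R.D * ((1 - R.β ^ t) / (1 - R.β)
        * ‖discountedMean R.β (fun s => gradient F (R.x s ω)) t‖)
      + R.D * ‖discountedSum R.β (R.noise F · ω) t‖) P := i4.add (i1.const_mul R.D)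
  rw [h1]
  refine (integral_mono (integrable_finsetSum _ i0) (i5.add (i2.const_mul (5 / 2 * R.D))) fun ω => ?_).trans ?_
  · have := discounted_loss_le R.stoGrad R.β R.x₀ (fun s => R.α s ω) (fun s => R.r s ω) hR.D_pos
      hR.β_pos t (fun s => gradient F (R.x s ω))
    rw [hR.discountedSum_eq_smul_mean ht] at this
    exact this
  · simp only [Pi.add_apply]
    rw [integral_add i5 (i2.const_mul (5 / 2 * R.D)),
      integral_add i4 (i1.const_mul R.D), integral_const_mul, integral_const_mul,
      integral_const_mul, integral_const_mul]
    -- The constant `7/2` is `1` from the noise plus `5/2` from the regret.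
    nlinarith [mul_le_mul_of_nonneg_left v1 hD.le, mul_le_mul_of_nonneg_left v2 hD.le]

theorem sum_pow_le {β : ℝ} (hβ0 : 0 ≤ β) (hβ1 : β < 1) (T : ℕ) :
    ∑ t ∈ Finset.Icc 1 T, β ^ t ≤ 1 / (1 - β) := by
  have hp : 0 < 1 - β := by linarith
  have h : (∑ t ∈ Finset.Icc 1 T, β ^ t) * (1 - β) = β - β ^ (T + 1) := by
    induction T with
    | zero => simp
    | succ T ih => rw [Finset.sum_Icc_succ_top (by omega), add_mul, ih]; ring
  rw [le_div_iff₀ hp, h]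
  have := pow_nonneg hβ0 (T + 1)
  linarith

theorem sum_integral_increment (hR : R.IsValid P ν F G sigma) (T : ℕ) :
    Integrable (fun ω => F (R.x T ω) - F R.x₀) P ∧
    ∑ t ∈ Finset.Icc 1 T, ∫ ω, inner ℝ (R.g t ω) (R.z (t - 1) ω) ∂P
      = ∫ ω, (F (R.x T ω) - F R.x₀) ∂P := by
  induction T with
  | zero => simp [R.x_zero]
  | succ T ih =>
    obtain ⟨i1, v1⟩ := ih
    have i2 := (hR.integral_increment T).1
    have h : ∀ ω, F (R.x (T + 1) ω) - F R.x₀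
        = (F (R.x T ω) - F R.x₀) + (F (R.x (T + 1) ω) - F (R.x T ω)) := fun ω => by ring
    rw [show (fun ω => F (R.x (T + 1) ω) - F R.x₀) = _ from funext h]
    refine ⟨i1.add i2, ?_⟩
    rw [Finset.sum_Icc_succ_top (by omega), v1, integral_add i1 i2, Nat.add_sub_cancel,
      (hR.integral_inner_g_z T).2]

/-- The total expected loss is at least `-Δ`, and each discounted loss is at most `-D (1 - β^t) / (1
- β)` times the mean gradient norm, plus an error. Replacing `1 - β^t` by `1` costs `D G β^t` in
round `t`, a geometric series. -/
theorem sum_integral_norm_discountedMean_le (hR : R.IsValid P ν F G sigma) {q : ℝ} (hq : 0 < q)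
    (hqβ : q ^ 2 = 1 - R.β) {Δ : ℝ} (hΔ : ∀ x, F R.x₀ - F x ≤ Δ) {T : ℕ} (hT : 1 ≤ T) :
    R.D * ∑ t ∈ Finset.Icc 1 T, ∫ ω, ‖discountedMean R.β (fun s => gradient F (R.x s ω)) t‖ ∂P
      ≤ Δ + R.D * (G / (1 - R.β))
        + 7 / 2 * R.D * ((G + sigma) / q) * ((1 - R.β) * T + R.β) := by
  have hβ0 := hR.β_pos.le
  have hβ1 := hR.β_lt_one
  have hp : 0 < 1 - R.β := by linarith
  have hD := hR.D_pos
  set n := fun t => ∫ ω, ‖discountedMean R.β (fun s => gradient F (R.x s ω)) t‖ ∂P with hn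
  set d := fun t => ∫ ω, inner ℝ (R.g t ω) (R.z (t - 1) ω) ∂P with hd
  set K := 7 / 2 * R.D * ((G + sigma) / q) with hK
  have hn0 : ∀ t, 0 ≤ n t := fun t => integral_nonneg fun ω => norm_nonneg _
  have hnG : ∀ t ∈ Finset.Icc 1 T, n t ≤ G := by
    intro t ht
    have ht1 := (Finset.mem_Icc.1 ht).1
    refine (integral_mono (hR.integrable_norm_discountedMean ht1) (integrable_const G)
      fun ω => hR.norm_discountedMean_gradient_le ht1 ω).trans (by simp)
  have hB : ∀ t ∈ Finset.Icc 1 T, (1 - R.β) * discountedSum R.β d t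
      ≤ -R.D * n t + R.D * (G * R.β ^ t) + (1 - R.β) * K := by
    intro t ht
    have h1 := mul_le_mul_of_nonneg_left
      (hR.discountedSum_loss_le hq hqβ (Finset.mem_Icc.1 ht).1) hp.le
    have h2 : (1 - R.β) * (-R.D * ((1 - R.β ^ t) / (1 - R.β) * n t) + K)
        = -R.D * n t + R.D * (n t * R.β ^ t) + (1 - R.β) * K := by field_simp; ring
    have h3 : R.D * (n t * R.β ^ t) ≤ R.D * (G * R.β ^ t) := by
      have := hnG t ht
      gcongr
    exact (h1.trans_eq h2).trans (by linarith)
  have hBT : R.β * discountedSum R.β d T ≤ R.β * K := by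
    refine mul_le_mul_of_nonneg_left ((hR.discountedSum_loss_le hq hqβ hT).trans ?_) hβ0
    have h1 := one_sub_pow_pos hβ0 hβ1 hT
    have : 0 ≤ R.D * ((1 - R.β ^ T) / (1 - R.β) * n T) := by
      have := hn0 T
      positivity
    change -R.D * ((1 - R.β ^ T) / (1 - R.β) * n T) + K ≤ K
    linarith
  obtain ⟨i1, v1⟩ := hR.sum_integral_increment T
  have hlow : -Δ ≤ ∑ t ∈ Finset.Icc 1 T, d t := by
    rw [v1]
    calc -Δ = ∫ _, -Δ ∂P := by simp
      _ ≤ _ := integral_mono (integrable_const _) i1 fun ω => by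
        have := hΔ (R.x T ω)
        simp only; linarith
  rw [sum_eq_discountedSum R.β d T] at hlow
  have hsum := Finset.sum_le_sum hB
  rw [Finset.sum_add_distrib, Finset.sum_add_distrib, ← Finset.mul_sum, ← Finset.mul_sum,
    ← Finset.mul_sum, Finset.sum_const, Nat.card_Icc, nsmul_eq_mul] at hsum
  have hgeo : R.D * (G * ∑ t ∈ Finset.Icc 1 T, R.β ^ t) ≤ R.D * (G / (1 - R.β)) := by
    have h1 := mul_le_mul_of_nonneg_left (sum_pow_le hβ0 hβ1 T) hR.G_nonneg
    rw [mul_one_div] at h1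
    exact mul_le_mul_of_nonneg_left h1 hD.le
  rw [Finset.mul_sum] at hgeo
  simp only [Nat.add_sub_cancel] at hsum
  linarith

/-- An infimum over uncountably many measures has no evident measurability in `x`; it comes from
continuity. The Dirac mass bounds the value by `G`. -/
theorem integrable_regGradNorm (hR : R.IsValid P ν F G sigma) {lam : ℝ} (hlam : 0 ≤ lam) (t : ℕ) :
    Integrable (fun ω => regGradNorm lam F (discountedMean R.β (R.x · ω) t)) P := by
  have hm : Measurable fun ω => discountedMean R.β (R.x · ω) t :=
    (Finset.measurable_sum _ fun s _ => (hR.measurable_x s).const_smul _).const_smul _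
  refine (integrable_const G).mono' ((continuous_regGradNorm hlam F hR.grad_le).measurable.comp
    hm).aestronglyMeasurable (ae_of_all _ fun ω => ?_)
  rw [Real.norm_of_nonneg (regGradNorm_nonneg hlam F _)]
  exact (regGradNorm_le_norm_gradient hlam F _).trans (hR.grad_le _)

theorem integral_regGradNorm_le (hR : R.IsValid P ν F G sigma) {lam : ℝ} (hlam : 0 ≤ lam) {t : ℕ}
    (ht : 1 ≤ t) :
    ∫ ω, regGradNorm lam F (discountedMean R.β (R.x · ω) t) ∂P
      ≤ ∫ ω, ‖discountedMean R.β (fun s => gradient F (R.x s ω)) t‖ ∂P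
        + lam * (R.D ^ 2 / (1 - R.β) ^ 2) := by
  obtain ⟨i1, v1⟩ := hR.integral_discountedVariance ht
  have i2 := hR.integrable_norm_discountedMean ht
  refine (integral_mono (hR.integrable_regGradNorm hlam t) (i2.add (i1.const_mul lam)) fun ω =>
    regGradNorm_discountedMean_le hlam F hR.β_pos.le hR.β_lt_one (R.x · ω) ht).trans ?_
  simp only [Pi.add_apply]
  rw [integral_add i2 (i1.const_mul lam), integral_const_mul]
  gcongr

theorem average_regGradNorm_le (hR : R.IsValid P ν F G sigma) {lam : ℝ} (hlam : 0 ≤ lam) {q : ℝ}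
    (hq : 0 < q) (hqβ : q ^ 2 = 1 - R.β) {Δ : ℝ} (hΔ : ∀ x, F R.x₀ - F x ≤ Δ) {T : ℕ}
    (hT : 1 ≤ T) :
    (1 / (T : ℝ)) * ∑ t ∈ Finset.Icc 1 T,
        ∫ ω, regGradNorm lam F (discountedMean R.β (R.x · ω) t) ∂P
      ≤ Δ / (R.D * T) + G / ((1 - R.β) * T)
        + 7 / 2 * ((G + sigma) / q) * ((1 - R.β) + R.β / T)
        + lam * (R.D ^ 2 / (1 - R.β) ^ 2) := by
  have hT0 : (0 : ℝ) < T := by exact_mod_cast hT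
  have hp : 0 < 1 - R.β := by linarith [hR.β_lt_one]
  have hD := hR.D_pos
  have h1 := Finset.sum_le_sum (s := Finset.Icc 1 T) fun t ht =>
    hR.integral_regGradNorm_le hlam (t := t) (Finset.mem_Icc.1 ht).1
  rw [Finset.sum_add_distrib, Finset.sum_const, Nat.card_Icc, nsmul_eq_mul,
    Nat.add_sub_cancel] at h1
  have h2 := hR.sum_integral_norm_discountedMean_le hq hqβ hΔ hT
  rw [mul_comm, ← le_div_iff₀ hD] at h2
  have h3 := h1.trans (add_le_add_left h2 _)
  rw [one_div, inv_mul_le_iff₀ hT0]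
  refine h3.trans (le_of_eq ?_)
  field_simp

end Run.IsValid

end RunBounds

/-! ### Choice of parameters and conclusion. -/

/-- Nonnegative measurable modifications of exponentially distributed random variables. -/
theorem exists_nonneg_modification {Ω : Type*} [MeasurableSpace Ω] {P : Measure Ω}
    {α : ℕ → Ω → ℝ} (h : ∀ t, HasLaw (α t) (expMeasure 1) P) :
    ∃ α' : ℕ → Ω → ℝ, (∀ t, Measurable (α' t)) ∧ (∀ t ω, 0 ≤ α' t ω) ∧ ∀ t, α t =ᵐ[P] α' t := by
  refine ⟨fun t ω => max ((h t).aemeasurable.mk (α t) ω) 0,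
    fun t => (h t).aemeasurable.measurable_mk.max measurable_const,
    fun t ω => le_max_right _ _, fun t => ?_⟩
  have h1 : ∀ᵐ ω ∂P, 0 ≤ α t ω :=
    ((h t).ae_iff (p := fun a => 0 ≤ a) (measurableSet_setOfPred.1 measurableSet_Ici)).2
      ae_nonneg_expMeasure_one
  filter_upwards [h1, (h t).aemeasurable.ae_eq_mk] with ω h2 h3
  rw [← h3, max_eq_left h2]

/-- The choice of parameters balances the four contributions. -/
theorem parameter_bound {G sigma lam C ε q D Δ T : ℝ} (hG : 0 ≤ G) (hs : 0 ≤ sigma)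
    (hlam : 0 < lam) (hC : 0 < C) (hε : 0 < ε) (hq : q = ε / (10 * C)) (hq1 : q < 1)
    (hD : D = q ^ 2 * Real.sqrt ε / (4 * Real.sqrt lam))
    (hT1 : 1 / q ^ 2 * (4 * Δ * Real.sqrt lam / ε ^ (3 / 2 : ℝ)) ≤ T)
    (hT2 : 1 / q ^ 2 * (12 * C / ε) ≤ T) :
    Δ / (D * T) + G / (q ^ 2 * T) + 7 / 2 * ((G + sigma) / q) * (q ^ 2 + (1 - q ^ 2) / T)
      + lam * (D ^ 2 / (q ^ 2) ^ 2) ≤ ε + ε / 16 + 15 / 16 * ((G + sigma) / C * ε) := by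
  have hq0 : 0 < q := by rw [hq]; positivity
  have hsl : 0 < Real.sqrt lam := Real.sqrt_pos.2 hlam
  have hse : 0 < Real.sqrt ε := Real.sqrt_pos.2 hε
  have hpow : ε ^ (3 / 2 : ℝ) = ε * Real.sqrt ε := by
    rw [Real.sqrt_eq_rpow, show (3 / 2 : ℝ) = 1 + 1 / 2 by norm_num, Real.rpow_add hε,
      Real.rpow_one]
  have hD0 : 0 < D := by rw [hD]; positivity
  have hT0 : 0 < T := lt_of_lt_of_le (by positivity) hT2
  have h1 : Δ / (D * T) ≤ ε := by
    rw [div_le_iff₀ (by positivity)]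
    have h := mul_le_mul_of_nonneg_left hT1 (mul_nonneg hε.le hD0.le)
    have e : ε * D * (1 / q ^ 2 * (4 * Δ * Real.sqrt lam / ε ^ (3 / 2 : ℝ))) = Δ := by
      rw [hpow, hD]; field_simp
    rw [e] at h
    linarith
  have hqT : 12 * C / ε ≤ q ^ 2 * T := by
    rwa [one_div, inv_mul_le_iff₀ (by positivity)] at hT2
  have hS : 0 ≤ (G + sigma) / C * ε := by positivity
  have h2 : G / (q ^ 2 * T) ≤ 1 / 12 * ((G + sigma) / C * ε) := by
    calc G / (q ^ 2 * T) ≤ (G + sigma) / (12 * C / ε) := by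
          gcongr
          linarith
      _ = _ := by field_simp
  have h3 : 7 / 2 * ((G + sigma) / q) * q ^ 2 = 7 / 20 * ((G + sigma) / C * ε) := by
    have : (G + sigma) / q * q ^ 2 = (G + sigma) * q := by field_simp
    rw [mul_assoc, this, hq]; ring
  have h4 : 7 / 2 * ((G + sigma) / q) * ((1 - q ^ 2) / T) ≤ 7 / 24 * ((G + sigma) / C * ε) := by
    have h5 : (1 - q ^ 2) / T ≤ q * (ε / (12 * C)) := by
      rw [div_le_iff₀ hT0]
      have h6 : 1 ≤ ε / (12 * C) * (q ^ 2 * T) := by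
        calc 1 = ε / (12 * C) * (12 * C / ε) := by field_simp
          _ ≤ _ := by gcongr
      have h7 : ε / (12 * C) * (q ^ 2 * T) ≤ q * (ε / (12 * C)) * T := by
        have : q ^ 2 ≤ q := by nlinarith
        calc ε / (12 * C) * (q ^ 2 * T) ≤ ε / (12 * C) * (q * T) := by gcongr
          _ = _ := by ring
      nlinarith [sq_nonneg q]
    calc _ ≤ 7 / 2 * ((G + sigma) / q) * (q * (ε / (12 * C))) := by gcongr
      _ = _ := by field_simp; ring
  have h5 : lam * (D ^ 2 / (q ^ 2) ^ 2) = ε / 16 := by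
    rw [hD, div_pow, mul_pow, mul_pow, Real.sq_sqrt hε.le, Real.sq_sqrt hlam.le]
    field_simp
    norm_num
  -- The coefficients of `(G + sigma) / C * ε` add up to `1/12 + 7/20 + 7/24 = 29/40 ≤ 15/16`. The
  -- last sixteenth is left to absorb `ε / 16` when `C ≤ G + sigma`.
  rw [mul_add, h3, h5]
  linarith

theorem mainTheorem1 {d : ℕ} {Ω Z : Type*} [MeasurableSpace Ω] [MeasurableSpace Z]
    (P : Measure Ω) [IsProbabilityMeasure P] (ν : Measure Z) [IsProbabilityMeasure ν]
    (F : EuclideanSpace ℝ (Fin d) → ℝ) (x₀ : EuclideanSpace ℝ (Fin d))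
    (stoGrad : EuclideanSpace ℝ (Fin d) → Z → EuclideanSpace ℝ (Fin d))
    (G sigma lam C ε β D : ℝ) (T : ℕ)
    -- the objective and the oracle
    (hF_diff : Differentiable ℝ F)
    (hF_bdd : BddBelow (Set.range F))
    (hF_wb : WellBehaved F)
    (hF_lip : ∀ x, ‖gradient F x‖ ≤ G)
    (h_sigma : 0 ≤ sigma)
    (h_oracle : IsStoGradOracle F stoGrad ν sigma)
    -- the parameters
    (h_lam : 0 < lam) (hC : 0 < C) (hε : 0 < ε) (hεC : ε < 10 * C)
    (hβ : β = 1 - (ε / (10 * C)) ^ 2)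
    (hD : D = (1 - β) * Real.sqrt ε / (4 * Real.sqrt lam))
    (hT : T = ⌈1 / (1 - β) *
      max (4 * initialGap F x₀ * Real.sqrt lam / ε ^ (3 / 2 : ℝ)) (12 * C / ε)⌉₊)
    -- the randomness of the algorithm: all the `α t` and `r t` are mutually independent
    (α : ℕ → Ω → ℝ) (r : ℕ → Ω → Z)
    (hα_law : ∀ t, HasLaw (α t) (expMeasure 1) P)
    (hr_law : ∀ t, HasLaw (r t) ν P)
    (hα_indep : iIndepFun α P)
    (hr_indep : iIndepFun r P)
    (hαr_indep : IndepFun (fun ω t => α t ω) (fun ω t => r t ω) P)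
    -- the model EMA after round `t` of the conversion with `β`-FTRL
    (xbar : ℕ → Ω → EuclideanSpace ℝ (Fin d))
    (h_xbar : ∀ t ω, xbar t ω = (conversion stoGrad (scaleFreeFTRL D) β x₀
      (fun s => α s ω) (fun s => r s ω) t).xbar) :
    0 < T ∧
    (∀ t ∈ Finset.Icc 1 T, Integrable (fun ω => regGradNorm lam F (xbar t ω)) P) ∧
    (1 / (T : ℝ)) * ∑ t ∈ Finset.Icc 1 T, ∫ ω, regGradNorm lam F (xbar t ω) ∂P
      ≤ (17 / 16 + (G + sigma) / C) * ε ∧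
    (C ≤ G + sigma →
      (1 / (T : ℝ)) * ∑ t ∈ Finset.Icc 1 T, ∫ ω, regGradNorm lam F (xbar t ω) ∂P
        ≤ (1 + (G + sigma) / C) * ε) := by
  -- The given variables are only almost everywhere measurable; the run uses measurable
  -- modifications, which change the EMA on a null set only.
  obtain ⟨α', hα'm, hα'0, hα'⟩ := exists_nonneg_modification hα_law
  set r' : ℕ → Ω → Z := fun t => (hr_law t).aemeasurable.mk (r t) with hr'_def
  have hr'm : ∀ t, Measurable (r' t) := fun t => (hr_law t).aemeasurable.measurable_mk
  have hr' : ∀ t, r t =ᵐ[P] r' t := fun t => (hr_law t).aemeasurable.ae_eq_mk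
  have hα_seq : (fun ω t => α t ω) =ᵐ[P] fun ω t => α' t ω := by
    filter_upwards [ae_all_iff.2 hα'] with ω h using funext h
  have hr_seq : (fun ω t => r t ω) =ᵐ[P] fun ω t => r' t ω := by
    filter_upwards [ae_all_iff.2 hr'] with ω h using funext h
  set q := ε / (10 * C) with hq
  have hq0 : 0 < q := by positivity
  have hq1 : q < 1 := by rw [hq, div_lt_one (by positivity)]; exact hεC
  have hqβ : q ^ 2 = 1 - β := by rw [hβ]; ring
  have hqsq : q ^ 2 < 1 := by nlinarith
  have hD0 : 0 < D := by
    rw [hD, ← hqβ]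
    have := Real.sqrt_pos.2 hε
    have := Real.sqrt_pos.2 h_lam
    positivity
  let R : Run Ω Z (EuclideanSpace ℝ (Fin d)) := ⟨stoGrad, D, β, x₀, α', r'⟩
  have hR : R.IsValid P ν F G sigma :=
    { D_pos := hD0
      β_pos := by change 0 < β; linarith
      β_lt_one := by change β < 1; linarith [pow_pos hq0 2]
      sigma_nonneg := h_sigma
      diff := hF_diff
      grad_le := hF_lip
      oracle := h_oracle
      measurable_α := hα'm
      measurable_r := hr'm
      α_nonneg := hα'0
      map_α := fun t => ((hα_law t).congr (hα' t).symm).map_eq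
      map_r := fun t => ((hr_law t).congr (hr' t).symm).map_eq
      indep_α := hα_indep.congr hα'
      indep_r := hr_indep.congr hr'
      indep_αr := hαr_indep.congr hα_seq hr_seq }
  have hxbar : ∀ t, 1 ≤ t → (fun ω => regGradNorm lam F (xbar t ω))
      =ᵐ[P] fun ω => regGradNorm lam F (discountedMean β (R.x · ω) t) := by
    intro t ht
    filter_upwards [hα_seq, hr_seq] with ω h1 h2
    rw [h_xbar, h1, h2, xbar_eq_discountedMean _ _ _ _ _ _ hR.β_pos.le hR.β_lt_one ht]
    rfl
  have hΔ : ∀ x, F x₀ - F x ≤ initialGap F x₀ := fun x => sub_le_sub_left (ciInf_le hF_bdd x) _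
  have hTle : 1 / q ^ 2 * max (4 * initialGap F x₀ * Real.sqrt lam / ε ^ (3 / 2 : ℝ)) (12 * C / ε)
      ≤ T := by
    rw [hT, hqβ]
    exact Nat.le_ceil _
  have hq2 : 0 ≤ 1 / q ^ 2 := by positivity
  have hT1 := (mul_le_mul_of_nonneg_left (le_max_left _ _) hq2).trans hTle
  have hT2 := (mul_le_mul_of_nonneg_left (le_max_right _ _) hq2).trans hTle
  have hT0 : 0 < T := by
    have : (0 : ℝ) < T := lt_of_lt_of_le (by positivity) hT2
    exact_mod_cast this
  have hmain : (1 / (T : ℝ)) * ∑ t ∈ Finset.Icc 1 T, ∫ ω, regGradNorm lam F (xbar t ω) ∂P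
      ≤ ε + ε / 16 + 15 / 16 * ((G + sigma) / C * ε) := by
    have h1 := hR.average_regGradNorm_le h_lam.le hq0 hqβ hΔ hT0
    have h2 := parameter_bound (D := D) hR.G_nonneg h_sigma h_lam hC hε hq hq1 (by rw [hD, hqβ]) hT1 hT2
    rw [show (1 : ℝ) - q ^ 2 = β by linarith, hqβ] at h2
    refine le_trans (le_of_eq ?_) (h1.trans h2)
    congr 1
    exact Finset.sum_congr rfl fun t ht => integral_congr_ae (hxbar t (Finset.mem_Icc.1 ht).1)
  have hS : 0 ≤ (G + sigma) / C * ε := by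
    have := hR.G_nonneg
    positivity
  refine ⟨hT0, fun t ht => ?_, by linarith, fun hCG => ?_⟩
  · exact (integrable_congr (hxbar t (Finset.mem_Icc.1 ht).1)).2
      (hR.integrable_regGradNorm h_lam.le t)
  · have : ε ≤ (G + sigma) / C * ε := le_mul_of_one_le_left hε.le ((one_le_div hC).2 hCG)
    linarith
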